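/- Conventions. A 2-category is strict; 2-functors, 2-natural transformations and 2-adjunctions are strict. A $2$-functor $F:\mathcal D^{op}\to\mathbf{Cat}$ is representable if there are a $0$-cell $L$ and a $2$-natural isomorphism $\mathcal D(-,L)\cong F$ (each component an isomorphism of categories). Monads. A monad in a 2-category $\mathcal D$ consists of a $0$-cell $\mathcal C$, a $1$-cell $T:\mathcal C\to\mathcal C$ and $2$-cells $\eta:1_{\mathcal C}\to T$, $\mu:T^2\to T$ with $\mu\circ T\eta=1_T=\mu\circ\eta_T$ and $\mu\circ T\mu=\mu\circ\mu_T$. Let $\mathbf{Mnd}(\mathcal D)$ be the 2-category of monads in $\mathcal D$. A $1$-cell $(\mathcal C,S)\to(\mathcal C',T)$ (a lax morphism) is a $1$-cell $F:\mathcal C\to\mathcal C'$ with a $2$-cell $\varphi:TF\to FS$ such that $\varphi\circ\eta^T_F=F\eta^S$ and $\varphi\circ\mu^T_F=F\mu^S\circ\varphi_S\circ T\varphi$; a $2$-cell $(F,\varphi)\to(F',\varphi')$ is a $2$-cell $\sigma:F\to F'$ with $\varphi'\circ T\sigma=\sigma_S\circ\varphi$. Let $\iota:\mathcal D\to\mathbf{Mnd}(\mathcal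 D)$ be the 2-functor that sends $X$ to the identity monad on $X$. The 2-category $\mathcal D$ admits Eilenberg–Moore objects if $\iota$ has a right 2-adjoint. A monad $T$ admits an Eilenberg–Moore object if the 2-functor $\mathbf{Mnd}(\iota(-),T):\mathcal D^{op}\to\mathbf{Cat}$ is representable. The weight. Let $\Delta$ be the category of the finite linear orders $n=\{0<\dots<n-1\}$, $n\ge 0$, and monotone functions. It is strict monoidal under ordinal sum $+$; let $\mathbf\Delta$ be the corresponding 2-category with one $0$-cell $\ast$, where the composite $n\circ m$ of $1$-cells is $n+m$. Let $\Pi_l$ be the category with the same objects as $\Delta$, whose morphisms $n\to m$ are the partial monotone functions $f$ such that, for $i\le j$ in $n$, if $f(j)$ is defined then so is $f(i)$. Let $W_l:\mathbf\Delta\to\mathbf{Cat}$ be the 2-functor with $W_l(\ast)=\Pi_l$, $W_l(n)=n+(-)$ and $W_l(f)=f+(-)$. Weighted limits. For 2-functors $W:\mathcal I\to\mathbf{Cat}$ and $\mathbf T:\mathcal I\to\mathcal D$ let $Cone_W(\mathbf T):\mathcal D^{op}\to\mathbf{Cat}$ be the 2-functor that sends $X$ to the category of 2-natural transformations $W\to\mathcal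 D(X,\mathbf T(-))$ and modifications, and acts on $1$-cells and $2$-cells by composition with $\mathcal D(F,\mathbf T(-))$ and $\mathcal D(\beta,\mathbf T(-))$. The 2-functor $\mathbf T$ has a $W$-weighted limit if $Cone_W(\mathbf T)$ is representable. Statement. For every 2-category $\mathcal D$: 1. $\mathcal D$ admits Eilenberg–Moore objects if and only if every 2-functor $\mathbf T:\mathbf\Delta\to\mathcal D$ has a $W_l$-weighted limit; 2. every monad in $\mathcal D$ admits an Eilenberg–Moore object if and only if every 2-functor $\mathbf T:\mathbf\Delta\to\mathcal D$ has a $W_l$-weighted limit. -/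

import Mathlib

open CategoryTheory Bicategory Opposite

universe w v u w₁ v₁ u₁ w₂ v₂ u₂ w₃ v₃ u₃ w₄ v₄ w₅ v₅

namespace TwoCat

lemma natTrans_conj_ext {C : Type u} [Category.{v} C] {E : Type u₁} [Category.{v₁} E]
    {A B A' B' : C ⥤ E} {η : A ⟶ B} {θ : A' ⟶ B'} (h : A = A') (h' : B' = B)
    (e : ∀ x, η.app x = eqToHom (Functor.congr_obj h x) ≫ θ.app x ≫
      eqToHom (Functor.congr_obj h' x)) : η = eqToHom h ≫ θ ≫ eqToHom h' := by
  subst h h'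
  exact NatTrans.ext (funext fun x => by simpa using e x)

/-! ### `Cat`-valued 2-functors and 2-natural transformations

A 2-category is a bicategory `B` with `[Strict B]`, a 2-functor is a `StrictPseudofunctor`. -/

section CatValued

variable {I : Type u₁} [Bicategory.{w₁, v₁} I]

/-- A 2-natural transformation `λ : F ⟶ G` between `Cat`-valued 2-functors. The sizes of the
categories in the values of `F` and of `G` may differ. -/
@[ext]
structure CatTrans (F : StrictPseudofunctor I Cat.{w₂, v₂})
    (G : StrictPseudofunctor I Cat.{w₃, v₃}) where
  app (i : I) : F.obj i ⥤ G.obj i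
  naturality {i j : I} (f : i ⟶ j) :
    (F.map f).toFunctor ⋙ app j = app i ⋙ (G.map f).toFunctor
  naturality₂ {i j : I} {f g : i ⟶ j} (α : f ⟶ g) :
    Functor.whiskerRight (F.map₂ α).toNatTrans (app j) =
      eqToHom (naturality f) ≫ Functor.whiskerLeft (app i) (G.map₂ α).toNatTrans ≫
        eqToHom (naturality g).symm

/-- A modification `ν : λ ⟶ λ'` between 2-natural transformations of `Cat`-valued 2-functors. -/
@[ext]
structure CatTrans.Modif {F : StrictPseudofunctor I Cat.{w₂, v₂}}
    {G : StrictPseudofunctor I Cat.{w₃, v₃}} (l l' : CatTrans F G) where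
  app (i : I) : l.app i ⟶ l'.app i
  naturality {i j : I} (f : i ⟶ j) :
    Functor.whiskerLeft (F.map f).toFunctor (app j) =
      eqToHom (l.naturality f) ≫ Functor.whiskerRight (app i) (G.map f).toFunctor ≫
        eqToHom (l'.naturality f).symm

instance (F : StrictPseudofunctor I Cat.{w₂, v₂}) (G : StrictPseudofunctor I Cat.{w₃, v₃}) :
    Category (CatTrans F G) where
  Hom l l' := CatTrans.Modif l l'
  id l := ⟨fun i => 𝟙 (l.app i), by simp⟩
  comp a b := ⟨fun i => a.app i ≫ b.app i, fun f => by simp [a.naturality, b.naturality]⟩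
  id_comp _ := CatTrans.Modif.ext (funext fun _ => Category.id_comp _)
  comp_id _ := CatTrans.Modif.ext (funext fun _ => Category.comp_id _)
  assoc _ _ _ := CatTrans.Modif.ext (funext fun _ => Category.assoc _ _ _)

/-- A 2-natural isomorphism between `Cat`-valued 2-functors: a 2-natural transformation whose
components are isomorphisms of categories. -/
structure CatIso (F : StrictPseudofunctor I Cat.{w₂, v₂})
    (G : StrictPseudofunctor I Cat.{w₃, v₃}) extends CatTrans F G where
  inv (i : I) : G.obj i ⥤ F.obj i
  hom_inv_id (i : I) : app i ⋙ inv i = 𝟭 (F.obj i)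
  inv_hom_id (i : I) : inv i ⋙ app i = 𝟭 (G.obj i)

namespace CatTrans

variable {F : StrictPseudofunctor I Cat.{w₂, v₂}} {G : StrictPseudofunctor I Cat.{w₃, v₃}}
  {H : StrictPseudofunctor I Cat.{w₄, v₄}}

@[simp] lemma modif_id_app (l : CatTrans F G) (i : I) : Modif.app (𝟙 l) i = 𝟙 (l.app i) := rfl

@[simp] lemma modif_comp_app {l l' l'' : CatTrans F G} (a : l ⟶ l') (b : l' ⟶ l'') (i : I) :
    Modif.app (a ≫ b) i = Modif.app a i ≫ Modif.app b i := rfl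

lemma modif_ext {l l' : CatTrans F G} {a b : l ⟶ l'}
    (h : ∀ i x, (Modif.app a i).app x = (Modif.app b i).app x) : a = b :=
  Modif.ext (funext fun i => NatTrans.ext (funext (h i)))

lemma eqToHom_modif_app {l l' : CatTrans F G} (h : l = l') (i : I) (x : F.obj i) :
    (Modif.app (eqToHom h) i).app x = eqToHom (by rw [h]) := by
  subst h; rfl

lemma modif_conj_ext {l l' k k' : CatTrans F G} {a : l ⟶ l'} {b : k ⟶ k'} (h : l = k)
    (h' : k' = l') (e : ∀ i x, (Modif.app a i).app x = eqToHom (by rw [h]) ≫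
      (Modif.app b i).app x ≫ eqToHom (by rw [h'])) : a = eqToHom h ≫ b ≫ eqToHom h' := by
  subst h h'
  exact modif_ext fun i x => by simpa using e i x

lemma naturality_map (l : CatTrans F G) {i j : I} (f : i ⟶ j) {x y : F.obj i} (e : x ⟶ y) :
    (l.app j).map ((F.map f).toFunctor.map e) =
      eqToHom (Functor.congr_obj (l.naturality f) x) ≫
        (G.map f).toFunctor.map ((l.app i).map e) ≫
          eqToHom (Functor.congr_obj (l.naturality f) y).symm :=
  Functor.congr_hom (l.naturality f) e

lemma naturality₂_app (l : CatTrans F G) {i j : I} {f g : i ⟶ j} (α : f ⟶ g) (x : F.obj i) :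
    (l.app j).map ((F.map₂ α).toNatTrans.app x) =
      eqToHom (Functor.congr_obj (l.naturality f) x) ≫
        (G.map₂ α).toNatTrans.app ((l.app i).obj x) ≫
          eqToHom (Functor.congr_obj (l.naturality g) x).symm := by
  have := NatTrans.congr_app (l.naturality₂ α) x
  simpa [eqToHom_app] using this

lemma Modif.naturality_app {l l' : CatTrans F G} (a : Modif l l') {i j : I} (f : i ⟶ j)
    (x : F.obj i) :
    (a.app j).app ((F.map f).toFunctor.obj x) =
      eqToHom (Functor.congr_obj (l.naturality f) x) ≫
        (G.map f).toFunctor.map ((a.app i).app x) ≫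
          eqToHom (Functor.congr_obj (l'.naturality f) x).symm := by
  have := NatTrans.congr_app (a.naturality f) x
  simpa [eqToHom_app] using this

/-- Composition of 2-natural transformations. -/
@[simps, reducible]
def comp (l : CatTrans F G) (m : CatTrans G H) : CatTrans F H where
  app i := l.app i ⋙ m.app i
  naturality f := by
    rw [← Functor.assoc, l.naturality, Functor.assoc, m.naturality, Functor.assoc]
  naturality₂ α := NatTrans.ext (funext fun x => by
    simp [eqToHom_app, naturality₂_app, eqToHom_map])

/-- Composition with a 2-natural transformation, as a functor. -/
@[simps]
def postcompose (F : StrictPseudofunctor I Cat.{w₂, v₂}) (m : CatTrans G H) :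
    CatTrans F G ⥤ CatTrans F H where
  obj l := l.comp m
  map a :=
    { app := fun i => Functor.whiskerRight (Modif.app a i) (m.app i)
      naturality := fun f => NatTrans.ext (funext fun x => by
        have := congrArg (m.app _).map (Modif.naturality_app a f x)
        simp only [Functor.map_comp, eqToHom_map, naturality_map] at this
        simpa [eqToHom_app] using this) }
  map_id l := modif_ext fun i x => (m.app i).map_id _
  map_comp a b := modif_ext fun i x => (m.app i).map_comp _ _

/-- Composition of a 2-natural transformation with a modification. -/
@[simps]
def compMap (l : CatTrans F G) {m m' : CatTrans G H} (b : m ⟶ m') :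
    Modif (l.comp m) (l.comp m') where
  app i := Functor.whiskerLeft (l.app i) (Modif.app b i)
  naturality f := NatTrans.ext (funext fun x => by
    have h := Functor.congr_obj (l.naturality f) x
    dsimp only [Functor.comp_obj] at h
    have := Modif.naturality_app b f ((l.app _).obj x)
    simp only [Functor.whiskerLeft_app]
    rw [NatTrans.congr (Modif.app b _) h]
    simp [eqToHom_app, this, eqToHom_map])

/-- Composition with a modification, as a natural transformation. -/
@[simps]
def postcomposeMap (F : StrictPseudofunctor I Cat.{w₂, v₂}) {m m' : CatTrans G H} (b : m ⟶ m') :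
    postcompose F m ⟶ postcompose F m' where
  app l := l.compMap b
  naturality _ _ _ := modif_ext fun i _ => (Modif.app b i).naturality _

/-- Restriction of a 2-natural transformation along a 2-functor. -/
@[simps]
def restrict {J : Type u₂} [Bicategory.{w₅, v₅} J] (T : StrictPseudofunctor J I)
    (l : CatTrans F G) : CatTrans (T.comp F) (T.comp G) where
  app j := l.app (T.obj j)
  naturality f := l.naturality (T.map f)
  naturality₂ α := l.naturality₂ (T.map₂ α)

/-- Restriction of a modification along a 2-functor. -/
@[simps]
def restrictMap {J : Type u₂} [Bicategory.{w₅, v₅} J] (T : StrictPseudofunctor J I)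
    {l l' : CatTrans F G} (a : l ⟶ l') : l.restrict T ⟶ l'.restrict T where
  app j := Modif.app a (T.obj j)
  naturality f := Modif.naturality a (T.map f)

end CatTrans

end CatValued

section Strict

variable {D : Type u} [Bicategory.{w, v} D] [Strict D]

/-- Whiskering with a 2-cell `α : f ⟶ g` on the target side, as a natural transformation. -/
@[simps]
def postcompMap (X : D) {Y Z : D} {f g : Y ⟶ Z} (α : f ⟶ g) : postcomp X f ⟶ postcomp X g where
  app h := h ◁ α
  naturality _ _ β := (whisker_exchange β α).symm

/-- Whiskering with a 2-cell `α : f ⟶ g` on the source side, as a natural transformation. -/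
@[simps]
def precompMap {X Y : D} (Z : D) {f g : X ⟶ Y} (α : f ⟶ g) : precomp Z f ⟶ precomp Z g where
  app h := α ▷ h
  naturality _ _ β := whisker_exchange α β

lemma postcompMap_id (X : D) {Y Z : D} (f : Y ⟶ Z) : postcompMap X (𝟙 f) = 𝟙 _ :=
  NatTrans.ext (funext fun h => whiskerLeft_id h f)

lemma postcompMap_comp (X : D) {Y Z : D} {f g h : Y ⟶ Z} (α : f ⟶ g) (β : g ⟶ h) :
    postcompMap X (α ≫ β) = postcompMap X α ≫ postcompMap X β :=
  NatTrans.ext (funext fun h => whiskerLeft_comp h α β)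

lemma precompMap_id {X Y : D} (Z : D) (f : X ⟶ Y) : precompMap Z (𝟙 f) = 𝟙 _ :=
  NatTrans.ext (funext fun h => id_whiskerRight f h)

lemma precompMap_comp {X Y : D} (Z : D) {f g h : X ⟶ Y} (α : f ⟶ g) (β : g ⟶ h) :
    precompMap Z (α ≫ β) = precompMap Z α ≫ precompMap Z β :=
  NatTrans.ext (funext fun h => comp_whiskerRight α β h)

lemma postcomp_id (X Y : D) : postcomp X (𝟙 Y) = 𝟭 (X ⟶ Y) :=
  CategoryTheory.Functor.ext (fun h => Strict.comp_id h) fun a b β => by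
    simp [Strict.rightUnitor_eqToIso]; rfl

lemma postcomp_comp (X : D) {Y Z W : D} (f : Y ⟶ Z) (g : Z ⟶ W) :
    postcomp X (f ≫ g) = postcomp X f ⋙ postcomp X g :=
  CategoryTheory.Functor.ext (fun h => (Strict.assoc h f g).symm) fun a b β => by
    dsimp only [Functor.comp_map, postcomp_map, precomp_map]
    simp [Strict.associator_eqToIso]
    rfl

lemma precomp_id (X Y : D) : precomp Y (𝟙 X) = 𝟭 (X ⟶ Y) :=
  CategoryTheory.Functor.ext (fun h => Strict.id_comp h) fun a b β => by
    simp [Strict.leftUnitor_eqToIso]; rfl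

lemma precomp_comp {X Y Z : D} (W : D) (f : X ⟶ Y) (g : Y ⟶ Z) :
    precomp W (f ≫ g) = precomp W g ⋙ precomp W f :=
  CategoryTheory.Functor.ext (fun h => Strict.assoc f g h) fun a b β => by
    dsimp only [Functor.comp_map, postcomp_map, precomp_map]
    simp [Strict.associator_eqToIso]
    rfl

lemma whiskerLeft_whiskerLeft {X Y Z W : D} (h : X ⟶ Y) (f : Y ⟶ Z) {g g' : Z ⟶ W}
    (α : g ⟶ g') : h ◁ f ◁ α =
      eqToHom (Strict.assoc h f g).symm ≫ (h ≫ f) ◁ α ≫ eqToHom (Strict.assoc h f g') := by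
  simp [Strict.associator_eqToIso]

lemma whiskerRight_whiskerRight {X Y Z W : D} {f f' : X ⟶ Y} (α : f ⟶ f') (g : Y ⟶ Z)
    (h : Z ⟶ W) : (α ▷ g) ▷ h =
      eqToHom (Strict.assoc f g h) ≫ α ▷ (g ≫ h) ≫ eqToHom (Strict.assoc f' g h).symm := by
  simp [Strict.associator_eqToIso]

lemma whiskerLeft_whiskerRight {X Y Z W : D} (f : X ⟶ Y) {g g' : Y ⟶ Z} (α : g ⟶ g')
    (h : Z ⟶ W) : f ◁ α ▷ h =
      eqToHom (Strict.assoc f g h).symm ≫ (f ◁ α) ▷ h ≫ eqToHom (Strict.assoc f g' h) := by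
  simp [Strict.associator_eqToIso]

lemma whiskerLeft_whiskerRight' {X Y Z W : D} (f : X ⟶ Y) {g g' : Y ⟶ Z} (α : g ⟶ g')
    (h : Z ⟶ W) : (f ◁ α) ▷ h =
      eqToHom (Strict.assoc f g h) ≫ f ◁ α ▷ h ≫ eqToHom (Strict.assoc f g' h).symm := by
  simp [Strict.associator_eqToIso]

lemma whiskerRight_comp_eq {X Y Z W : D} {f f' : X ⟶ Y} (α : f ⟶ f') (g : Y ⟶ Z)
    (h : Z ⟶ W) : α ▷ (g ≫ h) =
      eqToHom (Strict.assoc f g h).symm ≫ (α ▷ g) ▷ h ≫ eqToHom (Strict.assoc f' g h) := by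
  simp [Strict.associator_eqToIso]

lemma precomp_postcomp {X Y Z W : D} (f : X ⟶ Y) (g : Z ⟶ W) :
    postcomp Y g ⋙ precomp W f = precomp Z f ⋙ postcomp X g :=
  CategoryTheory.Functor.ext (fun h => (Strict.assoc f h g).symm) fun _ _ β =>
    whiskerLeft_whiskerRight f β g

lemma postcompMap_whiskerLeft (X : D) {Y Z W : D} (f : Y ⟶ Z) {g g' : Z ⟶ W} (α : g ⟶ g') :
    postcompMap X (f ◁ α) = eqToHom (postcomp_comp X f g) ≫
      Functor.whiskerLeft (postcomp X f) (postcompMap X α) ≫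
        eqToHom (postcomp_comp X f g').symm :=
  NatTrans.ext (funext fun h => by
    rw [NatTrans.comp_app, NatTrans.comp_app, eqToHom_app, eqToHom_app]
    exact whiskerLeft_whiskerLeft h f α)

lemma postcompMap_whiskerRight (X : D) {Y Z W : D} {f f' : Y ⟶ Z} (α : f ⟶ f') (g : Z ⟶ W) :
    postcompMap X (α ▷ g) = eqToHom (postcomp_comp X f g) ≫
      Functor.whiskerRight (postcompMap X α) (postcomp X g) ≫
        eqToHom (postcomp_comp X f' g).symm :=
  NatTrans.ext (funext fun h => by
    rw [NatTrans.comp_app, NatTrans.comp_app, eqToHom_app, eqToHom_app]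
    exact whiskerLeft_whiskerRight h α g)

lemma precompMap_whiskerRight {X Y Z : D} (W : D) {f f' : X ⟶ Y} (α : f ⟶ f') (g : Y ⟶ Z) :
    precompMap W (α ▷ g) = eqToHom (precomp_comp W f g) ≫
      Functor.whiskerLeft (precomp W g) (precompMap W α) ≫
        eqToHom (precomp_comp W f' g).symm :=
  NatTrans.ext (funext fun h => by
    rw [NatTrans.comp_app, NatTrans.comp_app, eqToHom_app, eqToHom_app]
    exact whiskerRight_whiskerRight α g h)

lemma precompMap_whiskerLeft {X Y Z : D} (W : D) (f : X ⟶ Y) {g g' : Y ⟶ Z} (α : g ⟶ g') :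
    precompMap W (f ◁ α) = eqToHom (precomp_comp W f g) ≫
      Functor.whiskerRight (precompMap W α) (precomp W f) ≫
        eqToHom (precomp_comp W f g').symm :=
  NatTrans.ext (funext fun h => by
    rw [NatTrans.comp_app, NatTrans.comp_app, eqToHom_app, eqToHom_app]
    exact whiskerLeft_whiskerRight' f α h)

end Strict

section Representables

variable {D : Type u} [Bicategory.{w, v} D] [Strict D]

/-- The covariant representable 2-functor `D(X, -) : D → Cat`. -/
def homFrom (X : D) : StrictPseudofunctor D Cat.{w, v} :=
  StrictPseudofunctor.mk''
    { obj := fun Y => Cat.of (X ⟶ Y)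
      map := fun f => (postcomp X f).toCatHom
      map₂ := fun α => (postcompMap X α).toCatHom₂
      map₂_id := fun f => Cat.Hom₂.ext (postcompMap_id X f)
      map₂_comp := fun α β => Cat.Hom₂.ext (postcompMap_comp X α β)
      map_id := fun Y => Cat.ext (postcomp_id X Y)
      map_comp := fun f g => Cat.ext (postcomp_comp X f g)
      map₂_whisker_left := fun f _ _ α => Cat.Hom₂.ext (by
        simp only [Cat.Hom.toNatTrans_comp, Cat.Hom₂.eqToHom_toNatTrans]
        exact postcompMap_whiskerLeft X f α)
      map₂_whisker_right := fun α g => Cat.Hom₂.ext (by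
        simp only [Cat.Hom.toNatTrans_comp, Cat.Hom₂.eqToHom_toNatTrans]
        exact postcompMap_whiskerRight X α g) }

lemma eqToHom_unop2 {X Y : Dᵒᵖ} {f g : X ⟶ Y} (h : f = g) :
    (eqToHom h).unop2 = eqToHom (congrArg Quiver.Hom.unop h) := by
  subst h; rfl

/-- The opposite (reversing 1-cells) of a 2-category is a 2-category. -/
instance : Strict Dᵒᵖ :=
  have l {X Y : Dᵒᵖ} (f : X ⟶ Y) : 𝟙 X ≫ f = f := congrArg Quiver.Hom.op (Strict.comp_id f.unop)
  have r {X Y : Dᵒᵖ} (f : X ⟶ Y) : f ≫ 𝟙 Y = f := congrArg Quiver.Hom.op (Strict.id_comp f.unop)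
  have a {X Y Z W : Dᵒᵖ} (f : X ⟶ Y) (g : Y ⟶ Z) (h : Z ⟶ W) : (f ≫ g) ≫ h = f ≫ g ≫ h :=
    congrArg Quiver.Hom.op (Strict.assoc h.unop g.unop f.unop).symm
  { id_comp := l
    comp_id := r
    assoc := a
    leftUnitor_eqToIso := fun f => Iso.ext (congrArg Bicategory.Opposite.Hom2.op2'
      ((congrArg Iso.hom (Strict.rightUnitor_eqToIso f.unop)).trans (eqToHom_unop2 (l f)).symm))
    rightUnitor_eqToIso := fun f => Iso.ext (congrArg Bicategory.Opposite.Hom2.op2'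
      ((congrArg Iso.hom (Strict.leftUnitor_eqToIso f.unop)).trans (eqToHom_unop2 (r f)).symm))
    associator_eqToIso := fun f g h => Iso.ext (congrArg Bicategory.Opposite.Hom2.op2'
      ((congrArg Iso.inv (Strict.associator_eqToIso h.unop g.unop f.unop)).trans
        (eqToHom_unop2 (a f g h)).symm)) }

/-- The contravariant representable 2-functor `D(-, L) : Dᵒᵖ → Cat`. -/
def homInto (L : D) : StrictPseudofunctor Dᵒᵖ Cat.{w, v} :=
  StrictPseudofunctor.mk''
    { obj := fun X => Cat.of (X.unop ⟶ L)
      map := fun f => (precomp L f.unop).toCatHom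
      map₂ := fun α => (precompMap L α.unop2).toCatHom₂
      map₂_id := fun f => Cat.Hom₂.ext (precompMap_id L f.unop)
      map₂_comp := fun α β => Cat.Hom₂.ext (precompMap_comp L α.unop2 β.unop2)
      map_id := fun X => Cat.ext (precomp_id X.unop L)
      map_comp := fun f g => Cat.ext (precomp_comp L g.unop f.unop)
      map₂_whisker_left := fun f _ _ α => Cat.Hom₂.ext (by
        simp only [Cat.Hom.toNatTrans_comp, Cat.Hom₂.eqToHom_toNatTrans]
        exact precompMap_whiskerRight L α.unop2 f.unop)
      map₂_whisker_right := fun α g => Cat.Hom₂.ext (by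
        simp only [Cat.Hom.toNatTrans_comp, Cat.Hom₂.eqToHom_toNatTrans]
        exact precompMap_whiskerLeft L g.unop α.unop2) }

/-- For `f : X ⟶ Y`, the 2-natural transformation `D(f, -) : D(Y, -) ⟶ D(X, -)`. -/
@[simps]
def homPre {X Y : D} (f : X ⟶ Y) : CatTrans (homFrom Y) (homFrom X) where
  app Z := precomp Z f
  naturality g := precomp_postcomp f g
  naturality₂ {_ _ g g'} α := natTrans_conj_ext (precomp_postcomp f g) (precomp_postcomp f g').symm
    fun h => whiskerLeft_whiskerLeft f h α

/-- For a 2-cell `α : f ⟶ f'`, the modification `D(α, -) : D(f, -) ⟶ D(f', -)`. -/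
@[simps]
def homPreMap {X Y : D} {f f' : X ⟶ Y} (α : f ⟶ f') : CatTrans.Modif (homPre f) (homPre f') where
  app Z := precompMap Z α
  naturality g := natTrans_conj_ext (precomp_postcomp f g) (precomp_postcomp f' g).symm
    fun h => whiskerRight_comp_eq α h g

variable {I : Type u₁} [Bicategory.{w₁, v₁} I]

/-- The 2-functor `D(X, T) : I → Cat` for a 2-functor `T : I → D`. -/
abbrev homFromComp (X : D) (T : StrictPseudofunctor I D) : StrictPseudofunctor I Cat.{w, v} :=
  T.comp (homFrom X)

/-- For `f : X ⟶ Y`, composition of `W`-cones with `D(f, T)`. -/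
abbrev conePre (W : StrictPseudofunctor I Cat.{w₂, v₂}) (T : StrictPseudofunctor I D) {X Y : D}
    (f : X ⟶ Y) : CatTrans W (homFromComp Y T) ⥤ CatTrans W (homFromComp X T) :=
  CatTrans.postcompose W ((homPre f).restrict T)

/-- For a 2-cell `α : f ⟶ f'`, composition of `W`-cones with `D(α, T)`. -/
abbrev conePreMap (W : StrictPseudofunctor I Cat.{w₂, v₂}) (T : StrictPseudofunctor I D)
    {X Y : D} {f f' : X ⟶ Y} (α : f ⟶ f') : conePre W T f ⟶ conePre W T f' :=
  CatTrans.postcomposeMap W (CatTrans.restrictMap T (l := homPre f) (l' := homPre f')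
    (homPreMap α))

variable (W : StrictPseudofunctor I Cat.{w₂, v₂}) (T : StrictPseudofunctor I D)

lemma conePreMap_id {X Y : D} (f : X ⟶ Y) : conePreMap W T (𝟙 f) = 𝟙 _ :=
  NatTrans.ext (funext fun _ => CatTrans.modif_ext fun _ _ => id_whiskerRight _ _)

lemma conePreMap_comp {X Y : D} {f g h : X ⟶ Y} (α : f ⟶ g) (β : g ⟶ h) :
    conePreMap W T (α ≫ β) = conePreMap W T α ≫ conePreMap W T β :=
  NatTrans.ext (funext fun _ => CatTrans.modif_ext fun _ _ => comp_whiskerRight _ _ _)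

lemma conePre_id (X : D) : conePre W T (𝟙 X) = 𝟭 _ :=
  CategoryTheory.Functor.ext
    (fun l => CatTrans.ext (funext fun i => congrArg (l.app i ⋙ ·) (precomp_id X (T.obj i))))
    fun _ _ a => CatTrans.modif_conj_ext _ _ fun i x =>
      Functor.congr_hom (precomp_id X (T.obj i)) ((CatTrans.Modif.app a i).app x)

lemma conePre_comp {X Y Z : D} (f : X ⟶ Y) (g : Y ⟶ Z) :
    conePre W T (f ≫ g) = conePre W T g ⋙ conePre W T f :=
  CategoryTheory.Functor.ext
    (fun l => CatTrans.ext (funext fun i =>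
      congrArg (l.app i ⋙ ·) (precomp_comp (T.obj i) f g)))
    fun _ _ a => CatTrans.modif_conj_ext _ _ fun i x =>
      Functor.congr_hom (precomp_comp (T.obj i) f g) ((CatTrans.Modif.app a i).app x)

lemma conePreMap_whiskerRight {X Y Z : D} {f f' : X ⟶ Y} (α : f ⟶ f') (g : Y ⟶ Z) :
    conePreMap W T (α ▷ g) = eqToHom (conePre_comp W T f g) ≫
      Functor.whiskerLeft (conePre W T g) (conePreMap W T α) ≫
        eqToHom (conePre_comp W T f' g).symm :=
  natTrans_conj_ext _ _ fun l => CatTrans.modif_conj_ext _ _ fun i x =>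
    whiskerRight_whiskerRight α g ((l.app i).obj x)

lemma conePreMap_whiskerLeft {X Y Z : D} (f : X ⟶ Y) {g g' : Y ⟶ Z} (α : g ⟶ g') :
    conePreMap W T (f ◁ α) = eqToHom (conePre_comp W T f g) ≫
      Functor.whiskerRight (conePreMap W T α) (conePre W T f) ≫
        eqToHom (conePre_comp W T f g').symm :=
  natTrans_conj_ext _ _ fun l => CatTrans.modif_conj_ext _ _ fun i x =>
    whiskerLeft_whiskerRight' f α ((l.app i).obj x)

/-- The 2-functor `Cone_W(T) : Dᵒᵖ → Cat` of `W`-cones over `T`: it sends `X` to the category of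
2-natural transformations `W ⟶ D(X, T)` and modifications, and it acts by composition with
`D(f, T)` and `D(α, T)`. -/
def Cone : StrictPseudofunctor Dᵒᵖ Cat.{max u₁ v₂ w, max u₁ w₂ v₂ w v} :=
  StrictPseudofunctor.mk''
    { obj := fun X => Cat.of (CatTrans W (homFromComp X.unop T))
      map := fun f => (conePre W T f.unop).toCatHom
      map₂ := fun α => (conePreMap W T α.unop2).toCatHom₂
      map₂_id := fun f => Cat.Hom₂.ext (conePreMap_id W T f.unop)
      map₂_comp := fun α β => Cat.Hom₂.ext (conePreMap_comp W T α.unop2 β.unop2)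
      map_id := fun X => Cat.ext (conePre_id W T X.unop)
      map_comp := fun f g => Cat.ext (conePre_comp W T g.unop f.unop)
      map₂_whisker_left := fun f _ _ α => Cat.Hom₂.ext (by
        simp only [Cat.Hom.toNatTrans_comp, Cat.Hom₂.eqToHom_toNatTrans]
        exact conePreMap_whiskerRight W T α.unop2 f.unop)
      map₂_whisker_right := fun α g => Cat.Hom₂.ext (by
        simp only [Cat.Hom.toNatTrans_comp, Cat.Hom₂.eqToHom_toNatTrans]
        exact conePreMap_whiskerLeft W T g.unop α.unop2) }

/-- `F : Dᵒᵖ → Cat` is representable: it is 2-naturally isomorphic to `D(-, L)` for some `L`. -/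
def IsRepresentable (F : StrictPseudofunctor Dᵒᵖ Cat.{w₃, v₃}) : Prop :=
  ∃ L : D, Nonempty (CatIso (homInto L) F)

end Representables

/-! ### The 2-category of monads in a 2-category -/

/-- A monad `(C, T, η, μ)` in `D`. The composite `T ∘ T` is written `t ≫ t`. -/
structure Mnd (D : Type u) [Bicategory.{w, v} D] where
  obj : D
  t : obj ⟶ obj
  η : 𝟙 obj ⟶ t
  μ : t ≫ t ⟶ t
  unit_left : η ▷ t ≫ μ = (λ_ t).hom
  unit_right : t ◁ η ≫ μ = (ρ_ t).hom
  assoc : μ ▷ t ≫ μ = (α_ t t t).hom ≫ t ◁ μ ≫ μ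

namespace Mnd

section
variable {D : Type u} [Bicategory.{w, v} D]

/-- A lax morphism of monads `(C, S) → (C', T)`: a 1-cell `F : C → C'` with a 2-cell
`φ : T ∘ F ⟶ F ∘ S` that is compatible with the units and the multiplications. -/
structure LaxHom (S T : Mnd D) where
  F : S.obj ⟶ T.obj
  φ : F ≫ T.t ⟶ S.t ≫ F
  unit : F ◁ T.η ≫ φ = (ρ_ F).hom ≫ (λ_ F).inv ≫ S.η ▷ F
  mul : F ◁ T.μ ≫ φ =
    (α_ F T.t T.t).inv ≫ φ ▷ T.t ≫ (α_ S.t F T.t).hom ≫ S.t ◁ φ ≫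
      (α_ S.t S.t F).inv ≫ S.μ ▷ F

/-- A transformation of lax morphisms of monads. -/
@[ext]
structure LaxHom.Trans {S T : Mnd D} (P Q : LaxHom S T) where
  σ : P.F ⟶ Q.F
  comm : σ ▷ T.t ≫ Q.φ = P.φ ≫ S.t ◁ σ

/-- The identity lax morphism. -/
@[simps, reducible]
def LaxHom.id (T : Mnd D) : LaxHom T T where
  F := 𝟙 T.obj
  φ := (λ_ T.t).hom ≫ (ρ_ T.t).inv
  unit := by bicategory
  mul := by bicategory

/-- Composition of lax morphisms. -/
@[simps, reducible]
def LaxHom.comp {R S T : Mnd D} (P : LaxHom R S) (Q : LaxHom S T) : LaxHom R T where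
  F := P.F ≫ Q.F
  φ := (α_ _ _ _).hom ≫ P.F ◁ Q.φ ≫ (α_ _ _ _).inv ≫ P.φ ▷ Q.F ≫ (α_ _ _ _).hom
  unit := calc
    _ = 𝟙 _ ⊗≫ P.F ◁ (Q.F ◁ T.η ≫ Q.φ) ⊗≫ P.φ ▷ Q.F ⊗≫ 𝟙 _ := by
      bicategory
    _ = 𝟙 _ ⊗≫ (P.F ◁ S.η ≫ P.φ) ▷ Q.F ⊗≫ 𝟙 _ := by
      rw [Q.unit]
      bicategory
    _ = _ := by
      rw [P.unit]
      bicategory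
  mul := calc
    _ = 𝟙 _ ⊗≫ P.F ◁ (Q.F ◁ T.μ ≫ Q.φ) ⊗≫ P.φ ▷ Q.F ⊗≫ 𝟙 _ := by
      bicategory
    _ = 𝟙 _ ⊗≫ P.F ◁ (Q.φ ▷ T.t ⊗≫ S.t ◁ Q.φ) ⊗≫ (P.F ◁ S.μ ≫ P.φ) ▷ Q.F ⊗≫ 𝟙 _ := by
      rw [Q.mul]
      bicategory
    _ = 𝟙 _ ⊗≫ P.F ◁ Q.φ ▷ T.t ⊗≫ ((P.F ≫ S.t) ◁ Q.φ ≫ P.φ ▷ (S.t ≫ Q.F)) ⊗≫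
          R.t ◁ P.φ ▷ Q.F ⊗≫ R.μ ▷ P.F ▷ Q.F ⊗≫ 𝟙 _ := by
      rw [P.mul]
      bicategory
    _ = _ := by
      rw [whisker_exchange]
      bicategory

instance : CategoryStruct (Mnd D) where
  Hom := LaxHom
  id := LaxHom.id
  comp := LaxHom.comp

instance homCategory (S T : Mnd D) : Category (S ⟶ T) where
  Hom P Q := LaxHom.Trans P Q
  id P := ⟨𝟙 _, by simp⟩
  comp a b := ⟨a.σ ≫ b.σ, by simp [b.comm, reassoc_of% a.comm]⟩
  id_comp _ := LaxHom.Trans.ext (Category.id_comp _)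
  comp_id _ := LaxHom.Trans.ext (Category.comp_id _)
  assoc _ _ _ := LaxHom.Trans.ext (Category.assoc _ _ _)

@[simp] lemma id_F (T : Mnd D) : LaxHom.F (𝟙 T) = 𝟙 T.obj := rfl
@[simp] lemma id_φ (T : Mnd D) : LaxHom.φ (𝟙 T) = (λ_ T.t).hom ≫ (ρ_ T.t).inv := rfl
@[simp] lemma comp_F {R S T : Mnd D} (P : R ⟶ S) (Q : S ⟶ T) :
    LaxHom.F (P ≫ Q) = LaxHom.F P ≫ LaxHom.F Q := rfl
@[simp] lemma comp_φ {R S T : Mnd D} (P : R ⟶ S) (Q : S ⟶ T) :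
    LaxHom.φ (P ≫ Q) = (α_ _ _ _).hom ≫ LaxHom.F P ◁ LaxHom.φ Q ≫ (α_ _ _ _).inv ≫
      LaxHom.φ P ▷ LaxHom.F Q ≫ (α_ _ _ _).hom := rfl
@[simp] lemma id_σ {S T : Mnd D} (P : S ⟶ T) : LaxHom.Trans.σ (𝟙 P) = 𝟙 (LaxHom.F P) := rfl
@[simp] lemma comp_σ {S T : Mnd D} {P Q R : S ⟶ T} (a : P ⟶ Q) (b : Q ⟶ R) :
    LaxHom.Trans.σ (a ≫ b) = LaxHom.Trans.σ a ≫ LaxHom.Trans.σ b := rfl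

lemma hom₂_ext {S T : Mnd D} {P Q : S ⟶ T} {a b : P ⟶ Q}
    (h : LaxHom.Trans.σ a = LaxHom.Trans.σ b) : a = b := LaxHom.Trans.ext h

/-- An invertible transformation of lax morphisms from an invertible 2-cell. -/
@[simps, reducible]
def isoMk {S T : Mnd D} {P Q : S ⟶ T} (e : LaxHom.F P ≅ LaxHom.F Q)
    (h : e.hom ▷ T.t ≫ LaxHom.φ Q = LaxHom.φ P ≫ S.t ◁ e.hom) : P ≅ Q where
  hom := ⟨e.hom, h⟩
  inv := ⟨e.inv, by
    rw [← cancel_epi (e.hom ▷ T.t)]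
    simp [reassoc_of% h]⟩
  hom_inv_id := LaxHom.Trans.ext e.hom_inv_id
  inv_hom_id := LaxHom.Trans.ext e.inv_hom_id

/-- Whiskering of a transformation with a lax morphism on the source side. -/
def LaxHom.whiskerLeft {R S T : Mnd D} (P : LaxHom R S) {Q Q' : LaxHom S T}
    (a : LaxHom.Trans Q Q') : LaxHom.Trans (P.comp Q) (P.comp Q') where
  σ := P.F ◁ a.σ
  comm := calc
    _ = 𝟙 _ ⊗≫ P.F ◁ (a.σ ▷ T.t ≫ Q'.φ) ⊗≫ P.φ ▷ Q'.F ⊗≫ 𝟙 _ := by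
      dsimp only [LaxHom.comp_φ, LaxHom.comp_F]
      bicategory
    _ = 𝟙 _ ⊗≫ P.F ◁ Q.φ ⊗≫ ((P.F ≫ S.t) ◁ a.σ ≫ P.φ ▷ Q'.F) ⊗≫ 𝟙 _ := by
      rw [a.comm]
      bicategory
    _ = _ := by
      rw [whisker_exchange]
      dsimp only [LaxHom.comp_φ, LaxHom.comp_F]
      bicategory

/-- Whiskering of a transformation with a lax morphism on the target side. -/
def LaxHom.whiskerRight {R S T : Mnd D} {P P' : LaxHom R S} (a : LaxHom.Trans P P')
    (Q : LaxHom S T) : LaxHom.Trans (P.comp Q) (P'.comp Q) where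
  σ := a.σ ▷ Q.F
  comm := calc
    _ = 𝟙 _ ⊗≫ (a.σ ▷ (Q.F ≫ T.t) ≫ P'.F ◁ Q.φ) ⊗≫ P'.φ ▷ Q.F ⊗≫ 𝟙 _ := by
      dsimp only [LaxHom.comp_φ, LaxHom.comp_F]
      bicategory
    _ = 𝟙 _ ⊗≫ P.F ◁ Q.φ ⊗≫ (a.σ ▷ S.t ≫ P'.φ) ▷ Q.F ⊗≫ 𝟙 _ := by
      rw [← whisker_exchange]
      bicategory
    _ = _ := by
      rw [a.comm]
      dsimp only [LaxHom.comp_φ, LaxHom.comp_F]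
      bicategory

lemma assoc_comm {R S T U : Mnd D} (P : LaxHom R S) (Q : LaxHom S T) (W : LaxHom T U) :
    (α_ P.F Q.F W.F).hom ▷ U.t ≫ (P.comp (Q.comp W)).φ =
      ((P.comp Q).comp W).φ ≫ R.t ◁ (α_ P.F Q.F W.F).hom := by
  dsimp only [LaxHom.comp]
  bicategory

lemma leftUnitor_comm {S T : Mnd D} (P : LaxHom S T) :
    (λ_ P.F).hom ▷ T.t ≫ P.φ = ((LaxHom.id S).comp P).φ ≫ S.t ◁ (λ_ P.F).hom := by
  dsimp only [LaxHom.comp, LaxHom.id]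
  bicategory

lemma rightUnitor_comm {S T : Mnd D} (P : LaxHom S T) :
    (ρ_ P.F).hom ▷ T.t ≫ P.φ = (P.comp (LaxHom.id T)).φ ≫ S.t ◁ (ρ_ P.F).hom := by
  dsimp only [LaxHom.comp, LaxHom.id]
  bicategory

/-- The 2-category `Mnd(D)` of monads in `D`, lax morphisms of monads and their
transformations. -/
instance bicategory : Bicategory (Mnd D) where
  whiskerLeft P _ _ a := LaxHom.whiskerLeft P a
  whiskerRight a Q := LaxHom.whiskerRight a Q
  associator P Q R := isoMk (P := (P ≫ Q) ≫ R) (Q := P ≫ Q ≫ R)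
    (α_ (LaxHom.F P) (LaxHom.F Q) (LaxHom.F R)) (assoc_comm P Q R)
  leftUnitor P := isoMk (P := 𝟙 _ ≫ P) (Q := P) (λ_ (LaxHom.F P)) (leftUnitor_comm P)
  rightUnitor P := isoMk (P := P ≫ 𝟙 _) (Q := P) (ρ_ (LaxHom.F P)) (rightUnitor_comm P)
  whiskerLeft_id _ _ := LaxHom.Trans.ext (whiskerLeft_id _ _)
  whiskerLeft_comp _ _ _ _ _ _ := LaxHom.Trans.ext (whiskerLeft_comp _ _ _)
  id_whiskerLeft _ := LaxHom.Trans.ext (id_whiskerLeft _)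
  comp_whiskerLeft _ _ _ _ _ := LaxHom.Trans.ext (comp_whiskerLeft _ _ _)
  id_whiskerRight _ _ := LaxHom.Trans.ext (id_whiskerRight _ _)
  comp_whiskerRight _ _ _ := LaxHom.Trans.ext (comp_whiskerRight _ _ _)
  whiskerRight_id _ := LaxHom.Trans.ext (whiskerRight_id _)
  whiskerRight_comp _ _ _ := LaxHom.Trans.ext (whiskerRight_comp _ _ _)
  whisker_assoc _ _ _ _ _ := LaxHom.Trans.ext (whisker_assoc _ _ _)
  whisker_exchange _ _ := LaxHom.Trans.ext (whisker_exchange _ _)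
  pentagon _ _ _ _ := LaxHom.Trans.ext (pentagon _ _ _ _)
  triangle _ _ := LaxHom.Trans.ext (triangle _ _)

lemma hom_ext_of_iso {S T : Mnd D} {P Q : S ⟶ T} (h : LaxHom.F P = LaxHom.F Q)
    (e : P ≅ Q) (he : e.hom.σ = eqToHom h) : P = Q := by
  obtain ⟨F, φ, _, _⟩ := P
  obtain ⟨F', φ', _, _⟩ := Q
  obtain rfl : F = F' := h
  have := e.hom.comm
  rw [he] at this
  simp only [eqToHom_refl, id_whiskerRight, whiskerLeft_id, Category.id_comp,
    Category.comp_id] at this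
  subst this
  rfl

lemma eqToHom_σ {S T : Mnd D} {P Q : S ⟶ T} (h : P = Q) :
    LaxHom.Trans.σ (eqToHom h) = eqToHom (congrArg LaxHom.F h) := by
  subst h; rfl

instance [Strict D] : Strict (Mnd D) :=
  have l {S T : Mnd D} (P : S ⟶ T) : (λ_ P).hom.σ = eqToHom (Strict.id_comp P.F) :=
    congrArg Iso.hom (Strict.leftUnitor_eqToIso (LaxHom.F P))
  have r {S T : Mnd D} (P : S ⟶ T) : (ρ_ P).hom.σ = eqToHom (Strict.comp_id P.F) :=
    congrArg Iso.hom (Strict.rightUnitor_eqToIso (LaxHom.F P))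
  have a {S T U V : Mnd D} (P : S ⟶ T) (Q : T ⟶ U) (R : U ⟶ V) :
      (α_ P Q R).hom.σ = eqToHom (Strict.assoc P.F Q.F R.F) :=
    congrArg Iso.hom (Strict.associator_eqToIso (LaxHom.F P) (LaxHom.F Q) (LaxHom.F R))
  { id_comp := fun P => hom_ext_of_iso _ (λ_ P) (l P)
    comp_id := fun P => hom_ext_of_iso _ (ρ_ P) (r P)
    assoc := fun P Q R => hom_ext_of_iso _ (α_ P Q R) (a P Q R)
    leftUnitor_eqToIso := fun P => Iso.ext (hom₂_ext (by rw [l, eqToIso.hom, eqToHom_σ]))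
    rightUnitor_eqToIso := fun P => Iso.ext (hom₂_ext (by rw [r, eqToIso.hom, eqToHom_σ]))
    associator_eqToIso := fun P Q R =>
      Iso.ext (hom₂_ext (by rw [a, eqToIso.hom, eqToHom_σ])) }

end

/-- The identity monad on `X`. -/
@[simps, reducible]
def idMonad {D : Type u} [Bicategory.{w, v} D] (X : D) : Mnd D where
  obj := X
  t := 𝟙 X
  η := 𝟙 _
  μ := (λ_ (𝟙 X)).hom
  unit_left := by simp
  unit_right := by simp [unitors_equal]
  assoc := by bicategory

/-- The 1-cell `F : X → Y` as a lax morphism between identity monads. -/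
@[simps, reducible]
def idLaxHom {D : Type u} [Bicategory.{w, v} D] {X Y : D} (F : X ⟶ Y) :
    LaxHom (idMonad X) (idMonad Y) where
  F := F
  φ := (ρ_ F).hom ≫ (λ_ F).inv
  unit := by dsimp; simp
  mul := by
    dsimp only [idMonad]
    bicategory

/-- The 2-functor `ι : D → Mnd(D)` that sends `X` to the identity monad on `X`. -/
def ι (D : Type u) [Bicategory.{w, v} D] [Strict D] : StrictPseudofunctor D (Mnd D) :=
  StrictPseudofunctor.mk''
    { obj := idMonad
      map := fun F => idLaxHom F
      map₂ := fun {_ _ f g} a => (⟨a, by dsimp; simp⟩ : LaxHom.Trans (idLaxHom f) (idLaxHom g))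
      map₂_id := fun _ => rfl
      map₂_comp := fun _ _ => rfl
      map_id := fun X => hom_ext_of_iso rfl (isoMk (Iso.refl (𝟙 X)) (by
        dsimp; simp [unitors_equal])) rfl
      map_comp := fun f g => hom_ext_of_iso rfl (isoMk (Iso.refl (f ≫ g)) (by
        dsimp; simp)) rfl
      map₂_whisker_left := fun f _ _ a => hom₂_ext (by simp [eqToHom_σ]; rfl)
      map₂_whisker_right := fun a f => hom₂_ext (by simp [eqToHom_σ]; rfl) }

end Mnd

/-! ### The simplicial category as a one-object 2-category -/

/-- Objects of the (algebraists') simplicial category `Δ`: the finite linear orders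
`{0 < ⋯ < n - 1}`, for `n ≥ 0`. -/
@[ext]
structure Delta where
  len : ℕ

namespace Delta

/-- Morphisms of `Δ`: monotone functions. -/
@[ext]
structure Hom (a b : Delta) where
  fn : Fin a.len → Fin b.len
  mono : Monotone fn

instance : Category Delta where
  Hom := Hom
  id _ := ⟨fun i => i, monotone_id⟩
  comp f g := ⟨fun i => g.fn (f.fn i), g.mono.comp f.mono⟩

/-- The ordinal sum of finite linear orders: first `a`, then `b`. -/
@[reducible]
def add (a b : Delta) : Delta := ⟨a.len + b.len⟩

lemma add_assoc (a b c : Delta) : add (add a b) c = add a (add b c) :=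
  Delta.ext (Nat.add_assoc _ _ _)

lemma add_zero (a : Delta) : add a ⟨0⟩ = a := rfl

lemma zero_add (a : Delta) : add ⟨0⟩ a = a := Delta.ext (Nat.zero_add _)

/-- The ordinal sum `f + g` of monotone functions. -/
def addHom {a b c d : Delta} (f : a ⟶ b) (g : c ⟶ d) : add a c ⟶ add b d where
  fn := Fin.addCases (fun i => Fin.castAdd d.len (f.fn i)) (fun j => Fin.natAdd b.len (g.fn j))
  mono := by
    intro i j
    refine Fin.addCases (fun i => ?_) (fun i => ?_) i <;>
      refine Fin.addCases (fun j => ?_) (fun j => ?_) j <;> intro h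
    · simp only [Fin.addCases_left]
      exact f.mono (show i ≤ j from h)
    · simp only [Fin.addCases_left, Fin.addCases_right, Fin.le_def, Fin.val_castAdd,
        Fin.val_natAdd]
      omega
    · simp only [Fin.le_def, Fin.val_castAdd, Fin.val_natAdd] at h
      omega
    · simp only [Fin.le_def, Fin.val_natAdd] at h
      simp only [Fin.addCases_right]
      have := g.mono (show i ≤ j by rw [Fin.le_def]; omega)
      simp only [Fin.le_def, Fin.val_natAdd] at this ⊢
      omega

/-- A morphism of `Δ` as a function on `ℕ`, continued by a shift; a device for calculations. -/
def act {a b : Delta} (f : a ⟶ b) (k : ℕ) : ℕ :=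
  if h : k < a.len then (f.fn ⟨k, h⟩).val else b.len + (k - a.len)

lemma act_ext {a b : Delta} {f g : a ⟶ b} (h : ∀ k, act f k = act g k) : f = g := by
  refine Hom.ext (funext fun i => Fin.ext ?_)
  have := h i
  simpa [act] using this

lemma act_lt {a b : Delta} (f : a ⟶ b) {k : ℕ} (h : k < a.len) : act f k < b.len := by
  simp [act, h]

lemma act_ge {a b : Delta} (f : a ⟶ b) {k : ℕ} (h : a.len ≤ k) :
    act f k = b.len + (k - a.len) := by
  simp [act, h]

@[simp] lemma act_id (a : Delta) (k : ℕ) : act (𝟙 a) k = k := by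
  by_cases h : k < a.len
  · simp only [act, h, dif_pos]; rfl
  · rw [act_ge _ (by omega)]; omega

@[simp] lemma act_comp {a b c : Delta} (f : a ⟶ b) (g : b ⟶ c) (k : ℕ) :
    act (f ≫ g) k = act g (act f k) := by
  by_cases h : k < a.len
  · have : act f k = (f.fn ⟨k, h⟩).val := by simp [act, h]
    simp only [this]
    simp only [act, h, dif_pos, Fin.is_lt]
    rfl
  · rw [act_ge f (by omega), act_ge _ (by omega), act_ge _ (by omega)]; omega

@[simp] lemma act_eqToHom {a b : Delta} (h : a = b) (k : ℕ) : act (eqToHom h) k = k := by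
  subst h; simp

lemma act_addHom {a b c d : Delta} (f : a ⟶ b) (g : c ⟶ d) (k : ℕ) :
    act (addHom f g) k = if k < a.len then act f k else b.len + act g (k - a.len) := by
  by_cases h : k < a.len
  · have e : (⟨k, by simp; omega⟩ : Fin (add a c).len) = Fin.castAdd c.len ⟨k, h⟩ := rfl
    rw [if_pos h, act, dif_pos (by simp; omega), e, act, dif_pos h]
    simp only [addHom, Fin.addCases_left, Fin.val_castAdd]
  · rw [if_neg h]
    by_cases h2 : k - a.len < c.len
    · have e : (⟨k, by simp; omega⟩ : Fin (add a c).len) = Fin.natAdd a.len ⟨k - a.len, h2⟩ :=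
        Fin.ext (by simp; omega)
      rw [act, dif_pos (by simp; omega), e, act, dif_pos h2]
      simp only [addHom, Fin.addCases_right, Fin.val_natAdd]
    · rw [act_ge _ (by simp; omega), act_ge _ (by omega)]
      simp
      omega

lemma addHom_id (a b : Delta) : addHom (𝟙 a) (𝟙 b) = 𝟙 (add a b) := act_ext fun k => by
  simp only [act_addHom, act_id]; split_ifs <;> omega

lemma addHom_comp {a a' a'' b b' b'' : Delta} (f : a ⟶ a') (f' : a' ⟶ a'') (g : b ⟶ b')
    (g' : b' ⟶ b'') : addHom (f ≫ f') (g ≫ g') = addHom f g ≫ addHom f' g' :=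
  act_ext fun k => by
    simp only [act_addHom, act_comp]
    by_cases h : k < a.len
    · simp only [h, if_true, act_lt f h]
    · simp only [h, if_false, Nat.not_lt.2 (Nat.le_add_right a'.len _), Nat.add_sub_cancel_left]

lemma addHom_zero {a b : Delta} (f : a ⟶ b) :
    addHom f (𝟙 ⟨0⟩) = eqToHom (add_zero a) ≫ f ≫ eqToHom (add_zero b).symm := act_ext fun k => by
  simp only [act_addHom, act_comp, act_eqToHom, act_id]
  split_ifs with hk
  · rfl
  · rw [act_ge f (by omega)]

lemma zero_addHom {a b : Delta} (f : a ⟶ b) :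
    addHom (𝟙 ⟨0⟩) f = eqToHom (zero_add a) ≫ f ≫ eqToHom (zero_add b).symm := act_ext fun k => by
  simp [act_addHom]

lemma addHom_assoc {a b c a' b' c' : Delta} (f : a ⟶ a') (g : b ⟶ b') (k : c ⟶ c') :
    addHom (addHom f g) k =
      eqToHom (add_assoc _ _ _) ≫ addHom f (addHom g k) ≫ eqToHom (add_assoc _ _ _).symm :=
  act_ext fun x => by
    simp only [act_addHom, act_comp, act_eqToHom]
    split_ifs <;> first | omega | rfl | (rw [Nat.sub_sub]; omega)

lemma addHom_assoc' {a b c a' b' c' : Delta} (f : a ⟶ a') (g : b ⟶ b') (k : c ⟶ c') :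
    addHom f (addHom g k) =
      eqToHom (add_assoc _ _ _).symm ≫ addHom (addHom f g) k ≫ eqToHom (add_assoc _ _ _) := by
  rw [addHom_assoc f g k]; simp


lemma addHom_eqToHom_id {a b : Delta} (h : a = b) (c : Delta) :
    addHom (eqToHom h) (𝟙 c) = eqToHom (congrArg (add · c) h) := by
  subst h; exact addHom_id _ _

lemma addHom_id_eqToHom {a b : Delta} (h : a = b) (c : Delta) :
    addHom (𝟙 c) (eqToHom h) = eqToHom (congrArg (add c ·) h) := by
  subst h; exact addHom_id _ _

end Delta

/-- The simplicial category, regarded as a 2-category with one 0-cell `∗`. -/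
inductive BDelta : Type
  | pt

namespace BDelta

/-- The 1-cells of `𝚫` are the objects `n` of `Δ` and its 2-cells are the morphisms of `Δ`.
The composite `n ∘ m` of 1-cells, which is written `m ≫ n`, is the ordinal sum `n + m`. -/
@[simps]
instance : CategoryStruct BDelta where
  Hom _ _ := Delta
  id _ := ⟨0⟩
  comp m n := Delta.add n m

instance homCategory (a b : BDelta) : Category (a ⟶ b) := inferInstanceAs (Category Delta)

instance bicategory : Bicategory BDelta where
  whiskerLeft m _ _ f := Delta.addHom f (𝟙 m)
  whiskerRight f n := Delta.addHom (𝟙 n) f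
  associator _ _ _ := eqToIso (Delta.add_assoc _ _ _).symm
  leftUnitor _ := eqToIso (Delta.add_zero _)
  rightUnitor _ := eqToIso (Delta.zero_add _)
  whiskerLeft_id _ _ := Delta.addHom_id _ _
  whiskerLeft_comp m _ _ _ f g := by
    rw [← Delta.addHom_comp, Category.id_comp]
  id_whiskerLeft f := Delta.addHom_zero f
  comp_whiskerLeft m n _ _ f := by
    refine (congrArg (Delta.addHom f) (Delta.addHom_id n m).symm).trans ?_
    exact Delta.addHom_assoc' f (𝟙 n) (𝟙 m)
  id_whiskerRight _ _ := Delta.addHom_id _ _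
  comp_whiskerRight f g n := by
    rw [← Delta.addHom_comp, Category.id_comp]
  whiskerRight_id f := Delta.zero_addHom f
  whiskerRight_comp f m n := by
    refine (congrArg (fun e => Delta.addHom e f) (Delta.addHom_id n m).symm).trans ?_
    exact Delta.addHom_assoc (𝟙 n) (𝟙 m) f
  whisker_assoc m _ _ f n := Delta.addHom_assoc' (𝟙 n) f (𝟙 m)
  whisker_exchange f g := by
    rw [← Delta.addHom_comp, ← Delta.addHom_comp]
    simp only [Category.id_comp, Category.comp_id]
  pentagon _ _ _ _ := by
    simp only [eqToIso.hom]
    rw [Delta.addHom_eqToHom_id, Delta.addHom_id_eqToHom]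
    exact (by simp : ∀ {a b c d e : Delta} (p : a = b) (q : b = c) (r : c = d) (s : a = e)
      (t : e = d), eqToHom p ≫ eqToHom q ≫ eqToHom r = eqToHom s ≫ eqToHom t) _ _ _ _ _
  triangle _ _ := by
    simp only [eqToIso.hom]
    rw [Delta.addHom_eqToHom_id, Delta.addHom_id_eqToHom]
    exact eqToHom_trans _ _

instance : Strict BDelta where
  id_comp _ := Delta.add_zero _
  comp_id _ := Delta.zero_add _
  assoc _ _ _ := (Delta.add_assoc _ _ _).symm
  leftUnitor_eqToIso _ := rfl
  rightUnitor_eqToIso _ := rfl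
  associator_eqToIso _ _ _ := rfl

end BDelta

/-! ### The left partial simplicial category and the weight `W_l` -/

/-- Objects of the left partial simplicial category `Π_l`: the finite linear orders
`{0 < ⋯ < n - 1}`, for `n ≥ 0`. -/
@[ext]
structure PiL where
  len : ℕ

namespace PiL

/-- Morphisms of `Π_l`: partial monotone functions (`none` means that the function is not
defined) whose domain of definition is an initial segment. -/
@[ext]
structure Hom (a b : PiL) where
  fn : Fin a.len → Option (Fin b.len)
  mono : ∀ i j, i ≤ j → ∀ x ∈ fn i, ∀ y ∈ fn j, x ≤ y
  initial : ∀ i j, i ≤ j → (fn j).isSome → (fn i).isSome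

instance : Category PiL where
  Hom := Hom
  id _ :=
    { fn := fun i => some i
      mono := by
        intro i j h x hx y hy
        simp only [Option.mem_def, Option.some.injEq] at hx hy
        rwa [← hx, ← hy]
      initial := fun _ _ _ _ => rfl }
  comp f g :=
    { fn := fun i => (f.fn i).bind g.fn
      mono := by
        intro i j h x hx y hy
        simp only [Option.mem_def, Option.bind_eq_some_iff] at hx hy
        obtain ⟨x', hx', hx⟩ := hx
        obtain ⟨y', hy', hy⟩ := hy
        exact g.mono x' y' (f.mono i j h x' hx' y' hy') x hx y hy
      initial := by
        intro i j h hj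
        simp only [Option.isSome_iff_exists, Option.bind_eq_some_iff] at hj
        obtain ⟨y, y', hy', hy⟩ := hj
        obtain ⟨x', hx'⟩ := Option.isSome_iff_exists.1 (f.initial i j h (by simp [hy']))
        rw [hx']
        exact g.initial x' y' (f.mono i j h x' hx' y' hy') (by simp [hy]) }
  id_comp _ := Hom.ext (funext fun _ => rfl)
  comp_id _ := Hom.ext (funext fun _ => by simp)
  assoc f g h := Hom.ext (funext fun i => Option.bind_assoc (f.fn i) g.fn h.fn)

/-- The ordinal sum `n + k` of an object of `Δ` and an object of `Π_l`. -/
@[reducible]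
def add (n : Delta) (k : PiL) : PiL := ⟨n.len + k.len⟩

/-- The ordinal sum `f + g` of a morphism of `Δ` and a morphism of `Π_l`. -/
def addHom {a b : Delta} {c d : PiL} (f : a ⟶ b) (g : c ⟶ d) : add a c ⟶ add b d where
  fn := Fin.addCases (fun i => some (Fin.castAdd d.len (f.fn i)))
    (fun j => (g.fn j).map (Fin.natAdd b.len))
  mono := by
    intro i j
    refine Fin.addCases (fun i => ?_) (fun i => ?_) i <;>
      refine Fin.addCases (fun j => ?_) (fun j => ?_) j <;> intro h x hx y hy <;>
      simp only [Fin.addCases_left, Fin.addCases_right, Option.mem_def, Option.some.injEq,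
        Option.map_eq_some_iff] at hx hy
    · rw [← hx, ← hy]
      exact f.mono (show i ≤ j from h)
    · obtain ⟨y, -, rfl⟩ := hy
      rw [← hx, Fin.le_def, Fin.val_castAdd, Fin.val_natAdd]
      omega
    · simp only [Fin.le_def, Fin.val_castAdd, Fin.val_natAdd] at h
      omega
    · obtain ⟨x, hx, rfl⟩ := hx
      obtain ⟨y, hy, rfl⟩ := hy
      simp only [Fin.le_def, Fin.val_natAdd] at h
      have := g.mono i j (by rw [Fin.le_def]; omega) x hx y hy
      simp only [Fin.le_def, Fin.val_natAdd] at this ⊢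
      omega
  initial := by
    intro i j
    refine Fin.addCases (fun i => ?_) (fun i => ?_) i <;>
      refine Fin.addCases (fun j => ?_) (fun j => ?_) j <;> intro h hj <;>
      simp only [Fin.addCases_left, Fin.addCases_right, Option.isSome_map,
        Option.isSome_some] at hj ⊢
    · simp only [Fin.le_def, Fin.val_castAdd, Fin.val_natAdd] at h
      omega
    · simp only [Fin.le_def, Fin.val_natAdd] at h
      exact g.initial i j (by rw [Fin.le_def]; omega) hj

/-- A morphism of `Π_l` as a partial function on `ℕ`, continued by a shift; a device for
calculations. -/
def act {a b : PiL} (f : a ⟶ b) (k : ℕ) : Option ℕ :=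
  if h : k < a.len then (f.fn ⟨k, h⟩).map Fin.val else some (b.len + (k - a.len))

lemma act_ext {a b : PiL} {f g : a ⟶ b} (h : ∀ k, act f k = act g k) : f = g := by
  refine Hom.ext (funext fun i => ?_)
  have := h i
  simp only [act, Fin.is_lt, dif_pos, Fin.eta] at this
  exact Option.map_injective Fin.val_injective this

lemma act_lt {a b : PiL} (f : a ⟶ b) {k : ℕ} (h : k < a.len) :
    act f k = (f.fn ⟨k, h⟩).map Fin.val := by
  simp [act, h]

lemma act_ge {a b : PiL} (f : a ⟶ b) {k : ℕ} (h : a.len ≤ k) :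
    act f k = some (b.len + (k - a.len)) := by
  simp [act, h]

@[simp] lemma act_id (a : PiL) (k : ℕ) : act (𝟙 a) k = some k := by
  by_cases h : k < a.len
  · rw [act_lt _ h]; rfl
  · rw [act_ge _ (by omega), Option.some.injEq]; omega

@[simp] lemma act_comp {a b c : PiL} (f : a ⟶ b) (g : b ⟶ c) (k : ℕ) :
    act (f ≫ g) k = (act f k).bind (act g) := by
  by_cases h : k < a.len
  · rw [act_lt _ h, act_lt _ h, Option.bind_map]
    change ((f.fn ⟨k, h⟩).bind g.fn).map Fin.val = _
    rw [Option.map_bind]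
    congr 1
    funext x
    simp [act_lt g x.isLt]
  · rw [act_ge f (by omega), act_ge _ (by omega), Option.bind_some, act_ge _ (by omega),
      Option.some.injEq]
    omega

@[simp] lemma act_eqToHom {a b : PiL} (h : a = b) (k : ℕ) : act (eqToHom h) k = some k := by
  subst h; simp

lemma act_addHom {a b : Delta} {c d : PiL} (f : a ⟶ b) (g : c ⟶ d) (k : ℕ) :
    act (addHom f g) k = if k < a.len then some (Delta.act f k)
      else (act g (k - a.len)).map (b.len + ·) := by
  by_cases h : k < a.len
  · have e : (⟨k, by simp; omega⟩ : Fin (add a c).len) = Fin.castAdd c.len ⟨k, h⟩ := rfl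
    rw [if_pos h, act_lt _ (by simp; omega), e, Delta.act, dif_pos h]
    simp only [addHom, Fin.addCases_left, Option.map_some, Fin.val_castAdd]
  · rw [if_neg h]
    by_cases h2 : k - a.len < c.len
    · have e : (⟨k, by simp; omega⟩ : Fin (add a c).len) = Fin.natAdd a.len ⟨k - a.len, h2⟩ :=
        Fin.ext (by simp; omega)
      rw [act_lt _ (by simp; omega), e, act_lt _ h2]
      simp only [addHom, Fin.addCases_right, Option.map_map]
      rfl
    · rw [act_ge _ (by simp; omega), act_ge _ (by omega)]
      simp
      omega

lemma add_assoc (a b : Delta) (c : PiL) : add (Delta.add a b) c = add a (add b c) :=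
  PiL.ext (Nat.add_assoc _ _ _)

lemma zero_add (c : PiL) : add ⟨0⟩ c = c := PiL.ext (Nat.zero_add _)

lemma addHom_id (a : Delta) (c : PiL) : addHom (𝟙 a) (𝟙 c) = 𝟙 (add a c) := act_ext fun k => by
  simp only [act_addHom, act_id, Delta.act_id, Option.map_some]
  split_ifs <;> simp only [Option.some.injEq]; omega

lemma addHom_comp {a a' a'' : Delta} {b b' b'' : PiL} (f : a ⟶ a') (f' : a' ⟶ a'')
    (g : b ⟶ b') (g' : b' ⟶ b'') :
    addHom (f ≫ f') (g ≫ g') = addHom f g ≫ addHom f' g' :=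
  act_ext fun k => by
    simp only [act_addHom, act_comp, Delta.act_comp]
    by_cases h : k < a.len
    · simp only [h, if_true, Option.bind_some, Delta.act_lt f h]
    · simp only [h, if_false, Option.map_bind, Option.bind_map]
      congr 1
      funext x
      simp

lemma zero_addHom {c d : PiL} (g : c ⟶ d) :
    addHom (𝟙 ⟨0⟩) g = eqToHom (zero_add c) ≫ g ≫ eqToHom (zero_add d).symm :=
  act_ext fun k => by
    simp only [act_addHom, act_comp, act_eqToHom, Option.bind_some]
    cases act g k <;> simp

lemma addHom_assoc {a b a' b' : Delta} {c c' : PiL} (f : a ⟶ a') (g : b ⟶ b') (k : c ⟶ c') :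
    addHom (Delta.addHom f g) k =
      eqToHom (add_assoc _ _ _) ≫ addHom f (addHom g k) ≫ eqToHom (add_assoc _ _ _).symm :=
  act_ext fun x => by
    simp only [act_addHom, Delta.act_addHom, act_comp, act_eqToHom, Option.bind_some,
      ← Nat.sub_sub]
    by_cases h1 : x < a.len
    · simp [h1, show x < a.len + b.len by omega]
    · by_cases h2 : x - a.len < b.len
      · simp [h1, h2, show x < a.len + b.len by omega]
      · simp only [h1, h2, show ¬ x < a.len + b.len by omega, if_false, Option.map_map]
        cases act k (x - a.len - b.len) <;> simp [Nat.add_assoc]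

/-- The functor `n + (-) : Π_l ⥤ Π_l`. -/
@[simps]
def addLeft (n : Delta) : PiL ⥤ PiL where
  obj k := add n k
  map g := addHom (𝟙 n) g
  map_id k := addHom_id n k
  map_comp g g' := by rw [← addHom_comp, Category.id_comp]

/-- The natural transformation `f + (-) : n + (-) ⟶ m + (-)` for `f : n ⟶ m` in `Δ`. -/
@[simps]
def addLeftMap {n m : Delta} (f : n ⟶ m) : addLeft n ⟶ addLeft m where
  app k := addHom f (𝟙 k)
  naturality k l g := by
    change addHom _ _ ≫ addHom _ _ = addHom _ _ ≫ addHom _ _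
    rw [← addHom_comp, ← addHom_comp]
    simp only [Category.id_comp, Category.comp_id]

lemma addLeftMap_id (n : Delta) : addLeftMap (𝟙 n) = 𝟙 (addLeft n) :=
  NatTrans.ext (funext fun k => addHom_id n k)

lemma addLeftMap_comp {n m l : Delta} (f : n ⟶ m) (g : m ⟶ l) :
    addLeftMap (f ≫ g) = addLeftMap f ≫ addLeftMap g :=
  NatTrans.ext (funext fun k => by
    change _ = addHom _ _ ≫ addHom _ _
    rw [← addHom_comp, Category.id_comp]; rfl)

lemma addLeft_zero : addLeft ⟨0⟩ = 𝟭 PiL :=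
  CategoryTheory.Functor.ext zero_add fun _ _ g => zero_addHom g

lemma addLeft_add (n m : Delta) : addLeft (Delta.add n m) = addLeft m ⋙ addLeft n :=
  CategoryTheory.Functor.ext (fun k => add_assoc n m k) fun _ _ g =>
    (congrArg (fun e => addHom e g) (Delta.addHom_id n m).symm).trans
      (addHom_assoc (𝟙 n) (𝟙 m) g)

lemma addLeftMap_whiskerLeft (m : Delta) {n n' : Delta} (f : n ⟶ n') :
    addLeftMap (Delta.addHom f (𝟙 m)) = eqToHom (addLeft_add n m) ≫
      Functor.whiskerLeft (addLeft m) (addLeftMap f) ≫ eqToHom (addLeft_add n' m).symm :=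
  NatTrans.ext (funext fun k => by
    simp only [NatTrans.comp_app, eqToHom_app]
    change addHom _ _ = _ ≫ addHom f (𝟙 (add m k)) ≫ _
    rw [← addHom_id]
    exact addHom_assoc f (𝟙 m) (𝟙 k))

lemma addLeftMap_whiskerRight {m m' : Delta} (f : m ⟶ m') (n : Delta) :
    addLeftMap (Delta.addHom (𝟙 n) f) = eqToHom (addLeft_add n m) ≫
      Functor.whiskerRight (addLeftMap f) (addLeft n) ≫ eqToHom (addLeft_add n m').symm :=
  NatTrans.ext (funext fun k => by
    simp only [NatTrans.comp_app, eqToHom_app]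
    exact addHom_assoc (𝟙 n) f (𝟙 k))

end PiL

/-- The weight `W_l : 𝚫 → Cat` with `W_l(∗) = Π_l`, `W_l(n) = n + (-)` and `W_l(f) = f + (-)`. -/
def Wl : StrictPseudofunctor BDelta Cat.{0, 0} :=
  StrictPseudofunctor.mk''
    { obj := fun _ => Cat.of PiL
      map := fun n => (PiL.addLeft n).toCatHom
      map₂ := fun f => (PiL.addLeftMap f).toCatHom₂
      map₂_id := fun n => Cat.Hom₂.ext (PiL.addLeftMap_id n)
      map₂_comp := fun f g => Cat.Hom₂.ext (PiL.addLeftMap_comp f g)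
      map_id := fun _ => Cat.ext PiL.addLeft_zero
      map_comp := fun m n => Cat.ext (PiL.addLeft_add n m)
      map₂_whisker_left := fun m _ _ f => Cat.Hom₂.ext (by
        simp only [Cat.Hom.toNatTrans_comp, Cat.Hom₂.eqToHom_toNatTrans]
        exact PiL.addLeftMap_whiskerLeft m f)
      map₂_whisker_right := fun f n => Cat.Hom₂.ext (by
        simp only [Cat.Hom.toNatTrans_comp, Cat.Hom₂.eqToHom_toNatTrans]
        exact PiL.addLeftMap_whiskerRight f n) }

/-! ### 2-adjunctions -/

section Adjunctions

variable {B : Type u₁} [Bicategory.{w₁, v₁} B] {C : Type u₂} [Bicategory.{w₂, v₂} C]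

/-- A 2-natural transformation between 2-functors. -/
structure TwoNatTrans (F G : StrictPseudofunctor B C) where
  app (a : B) : F.obj a ⟶ G.obj a
  naturality {a b : B} (f : a ⟶ b) : F.map f ≫ app b = app a ≫ G.map f
  naturality₂ {a b : B} {f g : a ⟶ b} (α : f ⟶ g) :
    F.map₂ α ▷ app b =
      eqToHom (naturality f) ≫ app a ◁ G.map₂ α ≫ eqToHom (naturality g).symm

/-- A 2-adjunction `F ⊣ G`: 2-natural transformations `unit : 1 ⟶ G ∘ F` and
`counit : F ∘ G ⟶ 1` that satisfy the triangle identities. -/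
structure TwoAdjunction (F : StrictPseudofunctor B C) (G : StrictPseudofunctor C B) where
  unit : TwoNatTrans (StrictPseudofunctor.id B) (F.comp G)
  counit : TwoNatTrans (G.comp F) (StrictPseudofunctor.id C)
  left_triangle (X : B) : F.map (unit.app X) ≫ counit.app (F.obj X) = 𝟙 (F.obj X)
  right_triangle (Y : C) : unit.app (G.obj Y) ≫ G.map (counit.app Y) = 𝟙 (G.obj Y)

variable [Strict B] [Strict C]

/-- The 2-functor `Fᵒᵖ : Bᵒᵖ → Cᵒᵖ`. -/
def opFunctor (F : StrictPseudofunctor B C) : StrictPseudofunctor Bᵒᵖ Cᵒᵖ :=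
  StrictPseudofunctor.mk''
    { obj := fun X => op (F.obj X.unop)
      map := fun f => (F.map f.unop).op
      map₂ := fun α => Bicategory.Opposite.op2 (F.map₂ α.unop2)
      map₂_id := fun f => congrArg Bicategory.Opposite.op2 (F.map₂_id f.unop)
      map₂_comp := fun α β => congrArg Bicategory.Opposite.op2 (F.map₂_comp α.unop2 β.unop2)
      map_id := fun X => congrArg Quiver.Hom.op (F.map_id X.unop)
      map_comp := fun f g => congrArg Quiver.Hom.op (F.map_comp g.unop f.unop)
      map₂_whisker_left := fun f _ _ α => congrArg Bicategory.Opposite.Hom2.op2' (by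
        simp only [Bicategory.Opposite.homCategory_comp_unop2, eqToHom_unop2]
        refine (F.map₂_whisker_right α.unop2 f.unop).trans ?_
        rw [F.mapComp_eq_eqToIso, F.mapComp_eq_eqToIso]
        rfl)
      map₂_whisker_right := fun α g => congrArg Bicategory.Opposite.Hom2.op2' (by
        simp only [Bicategory.Opposite.homCategory_comp_unop2, eqToHom_unop2]
        refine (F.map₂_whisker_left g.unop α.unop2).trans ?_
        rw [F.mapComp_eq_eqToIso, F.mapComp_eq_eqToIso]
        rfl) }

end Adjunctions

/-! ### Eilenberg–Moore objects and `W_l`-weighted limits -/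

section Main

variable {D : Type u} [Bicategory.{w, v} D] [Strict D]

/-- The 2-functor `T` has a `W`-weighted limit: `Cone_W(T)` is 2-naturally isomorphic to
`D(-, L)` for some `L`. -/
def HasWeightedLimit {I : Type u₁} [Bicategory.{w₁, v₁} I]
    (W : StrictPseudofunctor I Cat.{w₂, v₂}) (T : StrictPseudofunctor I D) : Prop :=
  IsRepresentable (Cone W T)

/-- The 2-functor `Mnd(ι(-), T) : Dᵒᵖ → Cat`. -/
def Mnd.homι (T : Mnd D) : StrictPseudofunctor Dᵒᵖ Cat.{w, max v w} :=
  (opFunctor (Mnd.ι D)).comp (homInto T)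

/-- The monad `T` admits an Eilenberg–Moore object: `Mnd(ι(-), T)` is representable. -/
def Mnd.AdmitsEMObject (T : Mnd D) : Prop := IsRepresentable T.homι

variable (D)

/-- The 2-category `D` admits Eilenberg–Moore objects: the 2-functor `ι : D → Mnd(D)` has a right
2-adjoint. -/
def AdmitsEMObjects : Prop :=
  ∃ EM : StrictPseudofunctor (Mnd D) D, Nonempty (TwoAdjunction (Mnd.ι D) EM)

/-- The 2-category `D` has the `W_l`-weighted limits of all 2-functors `𝚫 → D`. -/
def HasWlLimits : Prop :=
  ∀ T : StrictPseudofunctor BDelta D, HasWeightedLimit Wl T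

end Main

end TwoCat

namespace TwoCat

/-! A `W_l`-cone on `X` over `T` is the same thing as an algebra, with domain `X`, for the monad
`toMnd T` that `T` determines. Such a cone is a functor `L : Π_l ⥤ D(X, T ∗)` that turns ordinal sum
with `n` into composition with `T n`. On objects it is determined by `A = L 0`. On morphisms, every
`f : n ⟶ m` of `Π_l` factors as a total map `n ⟶ m + 1`, whose last value stands for "undefined",
followed by `m + (1 ⟶ 0)` (`PiL.hat_fac`). The value of `L` on total maps is prescribed by `T`, so
only the action `L (1 ⟶ 0) : A ≫ T 1 ⟶ A` remains. It satisfies the algebra laws because `0` is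
terminal in `Π_l`. Conversely, an algebra gives a functor because `hat` presents the maps of `Π_l`
as Kleisli maps for the monad `(-) + 1` on `Δ`: its unit and multiplication occur in `hat_id` and
`hat_comp` and are absorbed by the two algebra laws.

An algebra with domain `X` is a lax morphism from the identity monad on `X`, so `Cone Wl T` and
`(toMnd T).homι` are 2-naturally isomorphic (`WlCone.nonempty_catIso`). Hence `T` has a
`W_l`-weighted limit exactly when `toMnd T` admits an Eilenberg–Moore object.

Every monad is equal to some `toMnd T`, because `Δ` is the free strict monoidal category on a monoid
(`toMnd_toStrictPseudofunctor`). The 2-functor sends a monotone map to the horizontal composite of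
the iterated multiplications over its fibres. This gives the second equivalence. For the first, `ι`
has a right 2-adjoint if and only if every `Mnd(ι(-), T)` is representable (`admitsEMObjects_iff`),
as both amount to the existence of universal arrows. -/

/-! ### Isomorphisms of `Cat`-valued 2-functors -/

/-- A fully faithful functor that is bijective on objects has a strict inverse. -/
lemma exists_strict_inverse {C : Type u} [Category.{v} C] {E : Type u₁} [Category.{v₁} E]
    (F : C ⥤ E) [F.Full] [F.Faithful] (h : Function.Bijective F.obj) :
    ∃ G : E ⥤ C, F ⋙ G = 𝟭 C ∧ G ⋙ F = 𝟭 E := by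
  obtain ⟨g, hl, hr⟩ := Function.bijective_iff_has_inverse.1 h
  refine ⟨{ obj := g
            map := fun f => F.preimage (eqToHom (hr _) ≫ f ≫ eqToHom (hr _).symm)
            map_id := fun _ => F.map_injective (by simp)
            map_comp := fun _ _ => F.map_injective (by simp) }, ?_, ?_⟩
  · exact CategoryTheory.Functor.ext hl fun _ _ f => F.map_injective (by simp [eqToHom_map])
  · exact CategoryTheory.Functor.ext hr fun _ _ f => by simp

section CatIso

variable {I : Type u₁} [Bicategory.{w₁, v₁} I] {F : StrictPseudofunctor I Cat.{w₂, v₂}}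
  {G : StrictPseudofunctor I Cat.{w₃, v₃}} {H : StrictPseudofunctor I Cat.{w₄, v₄}}

/-- A 2-natural transformation whose components are fully faithful and bijective on objects is a
2-natural isomorphism. -/
lemma CatTrans.nonempty_catIso (l : CatTrans F G)
    (full : ∀ i x y, Function.Surjective ((l.app i).map : (x ⟶ y) → _))
    (faithful : ∀ i x y, Function.Injective ((l.app i).map : (x ⟶ y) → _))
    (bij : ∀ i, Function.Bijective (l.app i).obj) : Nonempty (CatIso F G) := by
  have key (i : I) := by
    have : (l.app i).Full := ⟨fun {x y} => full i x y⟩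
    have : (l.app i).Faithful := ⟨fun {x y} => @(faithful i x y)⟩
    exact exists_strict_inverse (l.app i) (bij i)
  choose g hg hg' using key
  exact ⟨{ l with inv := g, hom_inv_id := hg, inv_hom_id := hg' }⟩

/-- Composition of 2-natural isomorphisms. -/
def CatIso.trans (l : CatIso F G) (m : CatIso G H) : CatIso F H where
  __ := l.toCatTrans.comp m.toCatTrans
  inv i := m.inv i ⋙ l.inv i
  hom_inv_id i := by
    change l.app i ⋙ (m.app i ⋙ m.inv i) ⋙ l.inv i = _
    rw [m.hom_inv_id, Functor.id_comp, l.hom_inv_id]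
  inv_hom_id i := by
    change m.inv i ⋙ (l.inv i ⋙ l.app i) ⋙ m.app i = _
    rw [l.inv_hom_id, Functor.id_comp, m.inv_hom_id]

/-- The inverse of a 2-natural isomorphism. -/
def CatIso.symm (l : CatIso F G) : CatIso G F where
  app := l.inv
  inv := l.app
  hom_inv_id := l.inv_hom_id
  inv_hom_id := l.hom_inv_id
  naturality {i j} f := calc
    _ = (l.inv i ⋙ l.app i) ⋙ (G.map f).toFunctor ⋙ l.inv j := by rw [l.inv_hom_id]; rfl
    _ = l.inv i ⋙ (l.app i ⋙ (G.map f).toFunctor) ⋙ l.inv j := rfl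
    _ = l.inv i ⋙ (F.map f).toFunctor ⋙ (l.app j ⋙ l.inv j) := by rw [← l.naturality]; rfl
    _ = _ := by rw [l.hom_inv_id]; rfl
  naturality₂ {i j f g} α := natTrans_conj_ext _ _ fun x => by
    -- Every object is in the image of `l.app i`; there the claim is the 2-naturality of `l` carried
    -- over by `l.inv j`.
    obtain ⟨x, rfl⟩ : ∃ y, (l.app i).obj y = x :=
      ⟨(l.inv i).obj x, Functor.congr_obj (l.inv_hom_id i) x⟩
    have h := congrArg (l.inv j).map (l.naturality₂_app α x)
    have h' := Functor.congr_hom (l.hom_inv_id j) ((F.map₂ α).toNatTrans.app x)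
    rw [Functor.comp_map, h] at h'
    have h'' := NatTrans.congr (F.map₂ α).toNatTrans (Functor.congr_obj (l.hom_inv_id i) x)
    simp only [Functor.comp_obj, Functor.id_obj, Functor.id_map] at h'' h'
    simp only [Functor.whiskerRight_app, Functor.whiskerLeft_app]
    rw [h'']
    simp only [Functor.map_comp, eqToHom_map] at h'
    rw [eqToHom_comp_iff, ← Category.assoc, comp_eqToHom_iff] at h'
    rw [Category.assoc] at h'
    simp only [Category.assoc, eqToHom_map, eqToHom_trans, eqToHom_trans_assoc] at h' ⊢
    exact h'

end CatIso

section Representable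

variable {D : Type u} [Bicategory.{w, v} D] [Strict D]
  {F : StrictPseudofunctor Dᵒᵖ Cat.{w₃, v₃}} {G : StrictPseudofunctor Dᵒᵖ Cat.{w₄, v₄}}

lemma IsRepresentable.congr (l : CatIso F G) (h : IsRepresentable F) : IsRepresentable G := by
  obtain ⟨L, ⟨e⟩⟩ := h
  exact ⟨L, ⟨e.trans l⟩⟩

end Representable

/-! ### Heterogeneous equalities of 2-cells -/

section HEq

variable {D : Type u} [Bicategory.{w, v} D]

/-- In a strict 2-category the unit and associativity laws of 1-cells are propositional equalities,
so 2-cells that agree mathematically can have different types. Heterogeneous equality compares them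
without explicit `eqToHom`; whiskering and vertical composition respect it once the boundaries are
known to be equal. -/
lemma heq_whiskerLeft {X Y Z : D} {f f' : X ⟶ Y} {g g' h h' : Y ⟶ Z} {α : g ⟶ h} {β : g' ⟶ h'}
    (hf : f = f') (hg : g = g') (hh : h = h') (H : α ≍ β) : f ◁ α ≍ f' ◁ β := by
  subst hf hg hh; rw [eq_of_heq H]

lemma heq_whiskerRight {X Y Z : D} {f f' : Y ⟶ Z} {g g' h h' : X ⟶ Y} {α : g ⟶ h} {β : g' ⟶ h'}
    (hg : g = g') (hh : h = h') (hf : f = f') (H : α ≍ β) : α ▷ f ≍ β ▷ f' := by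
  subst hf hg hh; rw [eq_of_heq H]

lemma heq_comp_comp {C : Type u} [Category.{v} C] {a b c a' b' c' : C} {f : a ⟶ b} {g : b ⟶ c}
    {f' : a' ⟶ b'} {g' : b' ⟶ c'} (ha : a = a') (hb : b = b') (hc : c = c') (hf : f ≍ f')
    (hg : g ≍ g') : f ≫ g ≍ f' ≫ g' := by
  subst ha hb hc; rw [eq_of_heq hf, eq_of_heq hg]

lemma heq_id {C : Type u} [Category.{v} C] {a b : C} (h : a = b) : 𝟙 a ≍ 𝟙 b := by
  subst h; rfl

lemma heq_conj {C : Type u} [Category.{v} C] {a b a' b' : C} (h : a = a') (h' : b' = b)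
    (f : a' ⟶ b') : eqToHom h ≫ f ≫ eqToHom h' ≍ f := by
  subst h h'; simp

/-- The way back from heterogeneous equality to the `eqToHom` form in which 2-naturality and
2-functoriality are stated. -/
lemma eq_conj_of_heq {C : Type u} [Category.{v} C] {a b a' b' : C} {f : a ⟶ b} {g : a' ⟶ b'}
    (h : a = a') (h' : b' = b) (H : f ≍ g) : f = eqToHom h ≫ g ≫ eqToHom h' := by
  subst h h'; simpa using eq_of_heq H

variable [Strict D]

lemma comp_whiskerLeft_heq {X Y Z W : D} (f : X ⟶ Y) (g : Y ⟶ Z) {h h' : Z ⟶ W} (α : h ⟶ h') :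
    (f ≫ g) ◁ α ≍ f ◁ g ◁ α := by
  rw [whiskerLeft_whiskerLeft]; exact (heq_conj _ _ _).symm

lemma whiskerRight_comp_heq {X Y Z W : D} {f f' : X ⟶ Y} (α : f ⟶ f') (g : Y ⟶ Z) (h : Z ⟶ W) :
    α ▷ (g ≫ h) ≍ (α ▷ g) ▷ h := by
  rw [whiskerRight_comp_eq]; exact heq_conj _ _ _

lemma whisker_assoc_heq {X Y Z W : D} (f : X ⟶ Y) {g g' : Y ⟶ Z} (α : g ⟶ g') (h : Z ⟶ W) :
    (f ◁ α) ▷ h ≍ f ◁ α ▷ h := by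
  rw [whiskerLeft_whiskerRight']; exact heq_conj _ _ _

lemma id_whiskerLeft_heq {X Y : D} {f g : X ⟶ Y} (α : f ⟶ g) : 𝟙 X ◁ α ≍ α := by
  rw [id_whiskerLeft, Strict.leftUnitor_eqToIso, Strict.leftUnitor_eqToIso]
  exact heq_conj (Strict.id_comp f) (Strict.id_comp g).symm α

lemma whiskerRight_id_heq {X Y : D} {f g : X ⟶ Y} (α : f ⟶ g) : α ▷ 𝟙 Y ≍ α := by
  rw [whiskerRight_id, Strict.rightUnitor_eqToIso, Strict.rightUnitor_eqToIso]
  exact heq_conj (Strict.comp_id f) (Strict.comp_id g).symm α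

end HEq

section HEqMap

variable {B : Type u₁} [Bicategory.{w₁, v₁} B] {C : Type u₂} [Bicategory.{w₂, v₂} C]
  (F : StrictPseudofunctor B C)

lemma heq_map₂ {X Y : B} {f g f' g' : X ⟶ Y} {α : f ⟶ g} {β : f' ⟶ g'} (hf : f = f')
    (hg : g = g') (H : α ≍ β) : F.map₂ α ≍ F.map₂ β := by
  subst hf hg; rw [eq_of_heq H]

lemma map₂_whiskerLeft_heq {X Y Z : B} (f : X ⟶ Y) {g h : Y ⟶ Z} (α : g ⟶ h) :
    F.map₂ (f ◁ α) ≍ F.map f ◁ F.map₂ α := by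
  rw [F.map₂_whisker_left, F.mapComp_eq_eqToIso, F.mapComp_eq_eqToIso]
  exact heq_conj (F.map_comp f g) (F.map_comp f h).symm _

lemma map₂_whiskerRight_heq {X Y Z : B} {g h : X ⟶ Y} (α : g ⟶ h) (f : Y ⟶ Z) :
    F.map₂ (α ▷ f) ≍ F.map₂ α ▷ F.map f := by
  rw [F.map₂_whisker_right, F.mapComp_eq_eqToIso, F.mapComp_eq_eqToIso]
  exact heq_conj (F.map_comp g f) (F.map_comp h f).symm _

end HEqMap

/-! ### 2-adjunctions and universal arrows -/

section Universal

variable {B : Type u₁} [Bicategory.{w₁, v₁} B] {C : Type u₂} [Bicategory.{w₂, v₂} C]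

/-- The functor `F (-) ≫ p` from `B(X, L)` to `C(F X, Y)`. -/
@[simps]
def mapWhisker (F : StrictPseudofunctor B C) {L : B} {Y : C} (p : F.obj L ⟶ Y) (X : B) :
    (X ⟶ L) ⥤ (F.obj X ⟶ Y) where
  obj f := F.map f ≫ p
  map β := F.map₂ β ▷ p

/-- The 1-cell `p : F L ⟶ Y` is a (2-categorical) universal arrow from `F` to `Y`. -/
structure IsUniversalArrow (F : StrictPseudofunctor B C) {L : B} {Y : C} (p : F.obj L ⟶ Y) :
    Prop where
  existsUnique_map (X : B) (P : F.obj X ⟶ Y) : ∃! f : X ⟶ L, F.map f ≫ p = P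
  existsUnique_map₂ {X : B} (f g : X ⟶ L) (σ : F.map f ≫ p ⟶ F.map g ≫ p) :
    ∃! β : f ⟶ g, F.map₂ β ▷ p = σ

namespace IsUniversalArrow

variable {F : StrictPseudofunctor B C} {L : B} {Y : C} {p : F.obj L ⟶ Y}

lemma map_ext (h : IsUniversalArrow F p) {X : B} {f g : X ⟶ L}
    (e : F.map f ≫ p = F.map g ≫ p) : f = g :=
  (h.existsUnique_map X _).unique e rfl

lemma map₂_ext (h : IsUniversalArrow F p) {X : B} {f g : X ⟶ L} {β β' : f ⟶ g}
    (e : F.map₂ β ▷ p = F.map₂ β' ▷ p) : β = β' :=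
  (h.existsUnique_map₂ f g _).unique e rfl

lemma heq_ext (h : IsUniversalArrow F p) {X : B} {f g f' g' : X ⟶ L} {β : f ⟶ g} {β' : f' ⟶ g'}
    (hf : f = f') (hg : g = g') (e : F.map₂ β ▷ p ≍ F.map₂ β' ▷ p) : β ≍ β' := by
  subst hf hg
  exact heq_of_eq (h.map₂_ext (eq_of_heq e))

variable [Strict B] [Strict C]

/-- The functors `mapWhisker F p X` are 2-natural in `X`, and the two clauses of universality make
them bijective on objects and fully faithful. -/
lemma isRepresentable (h : IsUniversalArrow F p) :
    IsRepresentable ((opFunctor F).comp (homInto Y)) := by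
  have nat {X X' : Bᵒᵖ} (f : X ⟶ X') (g : X.unop ⟶ L) :
      F.map (f.unop ≫ g) ≫ p = F.map f.unop ≫ F.map g ≫ p := by
    rw [F.map_comp, Strict.assoc]
  refine ⟨L, CatTrans.nonempty_catIso
    { app := fun X => mapWhisker F p X.unop
      naturality := fun {X X'} f => CategoryTheory.Functor.ext (nat f) fun g g' β => ?_
      naturality₂ := fun {X X' f f'} α => natTrans_conj_ext _ _ fun g => ?_ }
    (fun X f g => fun σ => (h.existsUnique_map₂ f g σ).exists)
    (fun X f g β β' e => h.map₂_ext e)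
    (fun X => ⟨fun f g e => h.map_ext e, fun P => (h.existsUnique_map _ P).exists⟩)⟩
  · refine eq_conj_of_heq (nat f g) (nat f g').symm ?_
    change F.map₂ (f.unop ◁ β) ▷ p ≍ F.map f.unop ◁ F.map₂ β ▷ p
    exact (heq_whiskerRight (F.map_comp _ _) (F.map_comp _ _) rfl
      (map₂_whiskerLeft_heq F _ _)).trans (whisker_assoc_heq _ _ _)
  · refine eq_conj_of_heq (nat f g) (nat f' g).symm ?_
    change F.map₂ (α.unop2 ▷ g) ▷ p ≍ F.map₂ α.unop2 ▷ (F.map g ≫ p)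
    exact (heq_whiskerRight (F.map_comp _ _) (F.map_comp _ _) rfl
      (map₂_whiskerRight_heq F _ _)).trans (whiskerRight_comp_heq _ _ _).symm

end IsUniversalArrow

variable [Strict B] [Strict C]

/-- The Yoneda argument: the universal arrow is the image of `𝟙 L`, and 2-naturality forces the
representing isomorphism to be `F (-) ≫ p`, on 1-cells (`obj`) and on 2-cells (`map`). -/
lemma IsRepresentable.exists_isUniversalArrow {F : StrictPseudofunctor B C} {Y : C}
    (h : IsRepresentable ((opFunctor F).comp (homInto Y))) :
    ∃ (L : B) (p : F.obj L ⟶ Y), IsUniversalArrow F p := by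
  obtain ⟨L, ⟨l⟩⟩ := h
  let Φ (X : B) : (X ⟶ L) ⥤ (F.obj X ⟶ Y) := l.app (op X)
  let Ψ (X : B) : (F.obj X ⟶ Y) ⥤ (X ⟶ L) := l.inv (op X)
  have hΦ (X : B) : Φ X ⋙ Ψ X = 𝟭 _ := l.hom_inv_id (op X)
  have hΨ (X : B) : Ψ X ⋙ Φ X = 𝟭 _ := l.inv_hom_id (op X)
  have obj {X : B} (f : X ⟶ L) : F.map f ≫ (Φ L).obj (𝟙 L) = (Φ X).obj f := by
    refine (Functor.congr_obj (l.naturality f.op) (𝟙 L)).symm.trans ?_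
    exact congrArg (Φ X).obj (Strict.comp_id f)
  have map {X : B} {f g : X ⟶ L} (β : f ⟶ g) :
      F.map₂ β ▷ (Φ L).obj (𝟙 L) ≍ (Φ X).map β := by
    have h := l.naturality₂_app (Bicategory.Opposite.op2 β) (𝟙 L)
    have h' : (Φ X).map (β ▷ 𝟙 L) ≍ F.map₂ β ▷ (Φ L).obj (𝟙 L) :=
      (heq_of_eq h).trans (heq_conj _ _ _)
    have h'' : ∀ {a b a' b' : X ⟶ L} (u : a ⟶ b) (u' : a' ⟶ b'), a = a' → b = b' → u ≍ u' →
      (Φ X).map u ≍ (Φ X).map u' := by rintro a b _ _ u u' rfl rfl h; rw [eq_of_heq h]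
    exact h'.symm.trans (h'' _ _ (Strict.comp_id f) (Strict.comp_id g) (whiskerRight_id_heq β))
  refine ⟨L, (Φ L).obj (𝟙 L), fun X P => ⟨(Ψ X).obj P, ?_, fun f hf => ?_⟩,
    fun {X} f g σ => ⟨?_, ?_, fun β hβ => ?_⟩⟩
  · exact (obj _).trans (Functor.congr_obj (hΨ X) P)
  · rw [← hf, obj]
    exact (Functor.congr_obj (hΦ X) f).symm
  · exact eqToHom ((Functor.congr_obj (hΦ X) f).symm.trans (congrArg (Ψ X).obj (obj f).symm)) ≫
      (Ψ X).map σ ≫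
        eqToHom ((congrArg (Ψ X).obj (obj g)).trans (Functor.congr_obj (hΦ X) g))
  · refine eq_of_heq ((map _).trans ?_)
    simp only [Functor.map_comp, eqToHom_map]
    refine (heq_conj _ _ _).trans ?_
    exact Functor.hcongr_hom (hΨ X) σ
  · refine eq_of_heq (HEq.trans ?_ (heq_conj _ _ _).symm)
    have h'' : ∀ {a b a' b' : F.obj X ⟶ Y} (u : a ⟶ b) (u' : a' ⟶ b'), a = a' → b = b' → u ≍ u' →
      (Ψ X).map u ≍ (Ψ X).map u' := by rintro a b _ _ u u' rfl rfl h; rw [eq_of_heq h]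
    rw [← hβ]
    exact (Functor.hcongr_hom (hΦ X) β).symm.trans (h'' _ _ (obj f).symm (obj g).symm (map β).symm)

/-- If there are universal arrows from `F` to all 0-cells, then `F` has a right 2-adjoint. -/
lemma exists_twoAdjunction {F : StrictPseudofunctor B C}
    (h : ∀ Y, ∃ (L : B) (p : F.obj L ⟶ Y), IsUniversalArrow F p) :
    ∃ G : StrictPseudofunctor C B, Nonempty (TwoAdjunction F G) := by
  -- The right adjoint is defined on 1-cells and 2-cells by the requirement that `p` be 2-natural,
  -- so that `p` is the counit. All remaining equations hold because both sides agree after `F (-) ≫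
  -- p`.
  choose L p h using h
  choose map hmap using fun {S T : C} (P : S ⟶ T) =>
    ((h T).existsUnique_map (L S) (p S ≫ P)).exists
  choose map₂ hmap₂ using fun {S T : C} {P Q : S ⟶ T} (σ : P ⟶ Q) =>
    ((h T).existsUnique_map₂ (map P) (map Q)
      (eqToHom (hmap P) ≫ p S ◁ σ ≫ eqToHom (hmap Q).symm)).exists
  choose unit hunit using fun X : B => ((h (F.obj X)).existsUnique_map X (𝟙 _)).exists
  have hmap₂' {S T : C} {P Q : S ⟶ T} (σ : P ⟶ Q) : F.map₂ (map₂ σ) ▷ p T ≍ p S ◁ σ := by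
    rw [hmap₂]; exact heq_conj _ _ _
  have map_comp {S T U : C} (P : S ⟶ T) (Q : T ⟶ U) : map (P ≫ Q) = map P ≫ map Q :=
    (h U).map_ext (by
      rw [hmap, F.map_comp, Strict.assoc, hmap, ← Strict.assoc, ← Strict.assoc, hmap])
  let G : StrictPseudofunctor C B := StrictPseudofunctor.mk''
    { obj := L
      map := map
      map₂ := map₂
      map₂_id := fun P => (h _).map₂_ext (by rw [hmap₂]; simp)
      map₂_comp := fun σ τ => (h _).map₂_ext (by
        rw [hmap₂, F.map₂_comp, comp_whiskerRight, hmap₂, hmap₂]; simp)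
      map_id := fun S => (h _).map_ext (by rw [hmap, F.map_id, Strict.comp_id, Strict.id_comp])
      map_comp := map_comp
      map₂_whisker_left := fun {S T U} P Q Q' σ =>
        eq_conj_of_heq _ _ ((h U).heq_ext (map_comp _ _) (map_comp _ _)
          ((hmap₂' (P ◁ σ)).trans <| (comp_whiskerLeft_heq _ _ _).symm.trans <|
            (heq_whiskerLeft (hmap P).symm rfl rfl HEq.rfl).trans <|
            (comp_whiskerLeft_heq _ _ _).trans <|
            (heq_whiskerLeft rfl (hmap _).symm (hmap _).symm (hmap₂' σ).symm).trans <|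
            (whisker_assoc_heq _ _ _).symm.trans <|
            heq_whiskerRight (F.map_comp _ _).symm (F.map_comp _ _).symm rfl
              (map₂_whiskerLeft_heq F _ _).symm))
      map₂_whisker_right := fun {S T U} P P' σ Q =>
        eq_conj_of_heq _ _ ((h U).heq_ext (map_comp _ _) (map_comp _ _)
          ((hmap₂' (σ ▷ Q)).trans <| (whisker_assoc_heq _ _ _).symm.trans <|
            (heq_whiskerRight (hmap _).symm (hmap _).symm rfl (hmap₂' σ).symm).trans <|
            (whiskerRight_comp_heq _ _ _).symm.trans <|
            (heq_whiskerRight rfl rfl (hmap Q).symm HEq.rfl).trans <|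
            (whiskerRight_comp_heq _ _ _).trans <|
            heq_whiskerRight (F.map_comp _ _).symm (F.map_comp _ _).symm rfl
              (map₂_whiskerRight_heq F _ _).symm)) }
  have nat {X Y : B} (f : X ⟶ Y) : f ≫ unit Y = unit X ≫ map (F.map f) :=
    (h _).map_ext (by
      rw [F.map_comp, F.map_comp, Strict.assoc, Strict.assoc, hunit, hmap, ← Strict.assoc, hunit,
        Strict.comp_id, Strict.id_comp])
  exact ⟨G, ⟨{
    unit :=
      { app := unit
        naturality := nat
        naturality₂ := fun {X Y f g} α => eq_conj_of_heq (nat f) (nat g).symm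
          ((h _).heq_ext (nat f) (nat g)
            ((heq_whiskerRight (F.map_comp _ _) (F.map_comp _ _) rfl
              (map₂_whiskerRight_heq F _ _)).trans <|
            (whiskerRight_comp_heq _ _ _).symm.trans <|
            (heq_whiskerRight rfl rfl (hunit Y) HEq.rfl).trans <|
            (whiskerRight_id_heq _).trans <| (id_whiskerLeft_heq _).symm.trans <|
            (heq_whiskerLeft (hunit X).symm rfl rfl HEq.rfl).trans <|
            (comp_whiskerLeft_heq _ _ _).trans <|
            (heq_whiskerLeft rfl (hmap _).symm (hmap _).symm (hmap₂' _).symm).trans <|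
            (whisker_assoc_heq _ _ _).symm.trans <|
            heq_whiskerRight (F.map_comp _ _).symm (F.map_comp _ _).symm rfl
              (map₂_whiskerLeft_heq F _ _).symm)) }
    counit :=
      { app := p
        naturality := hmap
        naturality₂ := hmap₂ }
    left_triangle := hunit
    right_triangle := fun Y => (h Y).map_ext (by
      change F.map (unit (L Y) ≫ map (p Y)) ≫ p Y = F.map (𝟙 (L Y)) ≫ p Y
      rw [F.map_comp, Strict.assoc, hmap, ← Strict.assoc, hunit, F.map_id]) }⟩⟩

/-- The assignments `f ↦ F f ≫ c Y` and `P ↦ u X ≫ G P` are mutually inverse by the triangle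
identities, on 1-cells and on 2-cells. The data are unbundled so that no composite 2-functor occurs
in the types, and 2-naturality is heterogeneous so that the calculations chain. -/
lemma isUniversalArrow_of_triangles {F : StrictPseudofunctor B C} {G : StrictPseudofunctor C B}
    (u : ∀ X, X ⟶ G.obj (F.obj X)) (c : ∀ Y, F.obj (G.obj Y) ⟶ Y)
    (hu : ∀ {X X' : B} (f : X ⟶ X'), f ≫ u X' = u X ≫ G.map (F.map f))
    (hc : ∀ {S T : C} (P : S ⟶ T), F.map (G.map P) ≫ c T = c S ≫ P)
    (hu₂ : ∀ {X X' : B} {f g : X ⟶ X'} (α : f ⟶ g), α ▷ u X' ≍ u X ◁ G.map₂ (F.map₂ α))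
    (hc₂ : ∀ {S T : C} {P Q : S ⟶ T} (σ : P ⟶ Q), F.map₂ (G.map₂ σ) ▷ c T ≍ c S ◁ σ)
    (hl : ∀ X, F.map (u X) ≫ c (F.obj X) = 𝟙 (F.obj X))
    (hr : ∀ Y, u (G.obj Y) ≫ G.map (c Y) = 𝟙 (G.obj Y)) (Y : C) :
    IsUniversalArrow F (c Y) := by
  have inv {X : B} (f : X ⟶ G.obj Y) :
      u X ≫ G.map (F.map f ≫ c Y) = f := by
    rw [G.map_comp, ← Strict.assoc, ← hu, Strict.assoc, hr, Strict.comp_id]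
  have inv' {X : B} (P : F.obj X ⟶ Y) :
      F.map (u X ≫ G.map P) ≫ c Y = P := by
    rw [F.map_comp, Strict.assoc, hc, ← Strict.assoc, hl, Strict.id_comp]
  have inv₂ {X : B} {f g : X ⟶ G.obj Y} (β : f ⟶ g) :
      u X ◁ G.map₂ (F.map₂ β ▷ c Y) ≍ β :=
    (heq_whiskerLeft rfl (G.map_comp _ _) (G.map_comp _ _)
      (map₂_whiskerRight_heq G _ _)).trans <|
    (whisker_assoc_heq _ _ _).symm.trans <|
    (heq_whiskerRight (hu f).symm (hu g).symm rfl (hu₂ β).symm).trans <|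
    (whiskerRight_comp_heq _ _ _).symm.trans <|
    (heq_whiskerRight rfl rfl (hr Y) HEq.rfl).trans (whiskerRight_id_heq β)
  have inv₂' {X : B} {P Q : F.obj X ⟶ Y} (σ : P ⟶ Q) :
      F.map₂ (u X ◁ G.map₂ σ) ▷ c Y ≍ σ :=
    (heq_whiskerRight (F.map_comp _ _) (F.map_comp _ _) rfl
      (map₂_whiskerLeft_heq F _ _)).trans <|
    (whisker_assoc_heq _ _ _).trans <|
    (heq_whiskerLeft rfl (hc P) (hc Q) (hc₂ σ)).trans <|
    (comp_whiskerLeft_heq _ _ _).symm.trans <|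
    (heq_whiskerLeft (hl X) rfl rfl HEq.rfl).trans (id_whiskerLeft_heq σ)
  refine ⟨fun X P => ⟨u X ≫ G.map P, inv' P, fun f hf => by rw [← hf]; exact (inv f).symm⟩,
    fun {X} f g σ => ⟨eqToHom (inv f).symm ≫ (u X ◁ G.map₂ σ) ≫ eqToHom (inv g),
      eq_of_heq ?_, fun β hβ => ?_⟩⟩
  · exact (heq_whiskerRight (congrArg F.map (inv f).symm) (congrArg F.map (inv g).symm) rfl
      (heq_map₂ F (inv f).symm (inv g).symm (heq_conj _ _ _))).trans (inv₂' σ)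
  · rw [← hβ]
    exact eq_conj_of_heq _ _ (inv₂ β).symm

/-- The components of the counit of a 2-adjunction are universal arrows. -/
lemma TwoAdjunction.isUniversalArrow {F : StrictPseudofunctor B C} {G : StrictPseudofunctor C B}
    (adj : TwoAdjunction F G) (Y : C) : IsUniversalArrow F (L := G.obj Y) (adj.counit.app Y) :=
  isUniversalArrow_of_triangles adj.unit.app adj.counit.app adj.unit.naturality
    adj.counit.naturality
    (fun α => (heq_of_eq (adj.unit.naturality₂ α)).trans (heq_conj _ _ _))
    (fun σ => (heq_of_eq (adj.counit.naturality₂ σ)).trans (heq_conj _ _ _))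
    adj.left_triangle adj.right_triangle Y

end Universal

/-! ### Eilenberg–Moore objects of all monads and the right 2-adjoint of `ι` -/

section EilenbergMoore

variable {D : Type u} [Bicategory.{w, v} D] [Strict D]

/-- `D` admits Eilenberg–Moore objects if and only if every monad does. -/
lemma admitsEMObjects_iff : AdmitsEMObjects D ↔ ∀ T : Mnd D, T.AdmitsEMObject :=
  ⟨fun ⟨_, ⟨adj⟩⟩ T => (adj.isUniversalArrow T).isRepresentable,
    fun h => exists_twoAdjunction fun T => (h T).exists_isUniversalArrow⟩

end EilenbergMoore

/-! ### The monad of a 2-functor on `𝚫` -/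

namespace Delta

/-- The unique map to the terminal object of `Δ`. -/
def bang (n : Delta) : n ⟶ (⟨1⟩ : Delta) := ⟨fun _ => 0, fun _ _ _ => le_rfl⟩

instance (n : Delta) : Subsingleton (n ⟶ (⟨1⟩ : Delta)) :=
  ⟨fun _ _ => Hom.ext (funext fun _ => Subsingleton.elim _ _)⟩

lemma act_ext_lt {a b : Delta} {f g : a ⟶ b} (h : ∀ k < a.len, act f k = act g k) : f = g :=
  act_ext fun k => (lt_or_ge k a.len).elim (h k) fun hk => by rw [act_ge f hk, act_ge g hk]

end Delta

section Powers

variable {D : Type u} [Bicategory.{w, v} D] (T : StrictPseudofunctor BDelta D)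

/-- The value of a 2-functor `𝚫 → D` on the 0-cell. -/
abbrev base : D := T.obj BDelta.pt

/-- The value of a 2-functor `𝚫 → D` on the 1-cell `n`. -/
def pow (n : Delta) : base T ⟶ base T := T.map (X := BDelta.pt) (Y := BDelta.pt) n

/-- The value of a 2-functor `𝚫 → D` on a 2-cell. -/
def powMap {m n : Delta} (f : m ⟶ n) : pow T m ⟶ pow T n :=
  T.map₂ (a := BDelta.pt) (b := BDelta.pt) f

lemma pow_zero : pow T ⟨0⟩ = 𝟙 (base T) := T.map_id BDelta.pt

lemma pow_add (n m : Delta) : pow T (Delta.add n m) = pow T m ≫ pow T n :=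
  T.map_comp (a := BDelta.pt) (b := BDelta.pt) (c := BDelta.pt) m n

@[simp] lemma powMap_id (n : Delta) : powMap T (𝟙 n) = 𝟙 (pow T n) :=
  T.map₂_id (a := BDelta.pt) (b := BDelta.pt) n

lemma powMap_comp {m n l : Delta} (f : m ⟶ n) (g : n ⟶ l) :
    powMap T (f ≫ g) = powMap T f ≫ powMap T g :=
  T.map₂_comp (a := BDelta.pt) (b := BDelta.pt) f g

lemma powMap_addHom_id {n n' : Delta} (f : n ⟶ n') (m : Delta) :
    powMap T (Delta.addHom f (𝟙 m)) ≍ pow T m ◁ powMap T f :=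
  map₂_whiskerLeft_heq (X := BDelta.pt) (Y := BDelta.pt) (Z := BDelta.pt) T m f

lemma powMap_id_addHom {m m' : Delta} (f : m ⟶ m') (n : Delta) :
    powMap T (Delta.addHom (𝟙 n) f) ≍ powMap T f ▷ pow T n :=
  map₂_whiskerRight_heq (X := BDelta.pt) (Y := BDelta.pt) (Z := BDelta.pt) T f n

/-- As `1` is terminal in `Δ`, any two 2-cells that come from maps to `1` agree; all three monad
laws of `toMnd` are instances of this. -/
lemma powMap_heq_of_terminal {m m' : Delta} (h : m = m') (f : m ⟶ (⟨1⟩ : Delta))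
    (f' : m' ⟶ (⟨1⟩ : Delta)) : powMap T f ≍ powMap T f' := by
  subst h; rw [Subsingleton.elim f f']

variable [Strict D]

/-- The monad that underlies a 2-functor `𝚫 → D`. -/
def toMnd : Mnd D where
  obj := base T
  t := pow T ⟨1⟩
  η := eqToHom (pow_zero T).symm ≫ powMap T (Delta.bang ⟨0⟩)
  μ := eqToHom (pow_add T ⟨1⟩ ⟨1⟩).symm ≫ powMap T (Delta.bang _)
  -- In each law a whiskered `η` or `μ` is the image of an ordinal sum with `𝟙 ⟨1⟩`. Both sides are
  -- thus images of maps to `1`, from `1` in the unit laws and from `3` in the associative law.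
  unit_left := eq_of_heq <| by
    rw [Strict.leftUnitor_eqToIso]
    refine HEq.trans (b := powMap T (Delta.addHom (𝟙 ⟨1⟩) (Delta.bang ⟨0⟩) ≫ Delta.bang _)) ?_ ?_
    · rw [powMap_comp]
      refine heq_comp_comp ?_ (pow_add T ⟨1⟩ ⟨1⟩).symm rfl ?_ (eqToHom_comp_heq _ _)
      · rw [pow_add, pow_zero]
      · exact (heq_whiskerRight (pow_zero T).symm rfl rfl (eqToHom_comp_heq _ _)).trans
          (powMap_id_addHom T (Delta.bang ⟨0⟩) ⟨1⟩).symm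
    · refine (powMap_heq_of_terminal T (m' := ⟨1⟩) rfl _ (𝟙 _)).trans ?_
      rw [powMap_id]
      exact (eqToHom_heq_id_cod _ _ (Strict.id_comp _)).symm
  unit_right := eq_of_heq <| by
    rw [Strict.rightUnitor_eqToIso]
    refine HEq.trans (b := powMap T (Delta.addHom (Delta.bang ⟨0⟩) (𝟙 ⟨1⟩) ≫ Delta.bang _)) ?_ ?_
    · rw [powMap_comp]
      refine heq_comp_comp ?_ (pow_add T ⟨1⟩ ⟨1⟩).symm rfl ?_ (eqToHom_comp_heq _ _)
      · rw [pow_add, pow_zero]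
      · exact (heq_whiskerLeft rfl (pow_zero T).symm rfl (eqToHom_comp_heq _ _)).trans
          (powMap_addHom_id T (Delta.bang ⟨0⟩) ⟨1⟩).symm
    · refine (powMap_heq_of_terminal T (m' := ⟨1⟩) rfl _ (𝟙 _)).trans ?_
      rw [powMap_id]
      exact (eqToHom_heq_id_cod _ _ (Strict.comp_id _)).symm
  assoc := eq_of_heq <| by
    rw [Strict.associator_eqToIso]
    refine HEq.trans (b := powMap T (Delta.addHom (𝟙 ⟨1⟩) (Delta.bang (Delta.add ⟨1⟩ ⟨1⟩)) ≫
      Delta.bang _)) ?_ ?_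
    · rw [powMap_comp]
      refine heq_comp_comp ?_ (pow_add T ⟨1⟩ ⟨1⟩).symm rfl ?_ (eqToHom_comp_heq _ _)
      · rw [pow_add, pow_add]
      · exact (heq_whiskerRight (pow_add T _ _).symm rfl rfl (eqToHom_comp_heq _ _)).trans
          (powMap_id_addHom T _ ⟨1⟩).symm
    · refine HEq.trans ?_ (eqToHom_comp_heq _ (Strict.assoc _ _ _)).symm
      refine HEq.trans (b := powMap T (Delta.addHom (Delta.bang (Delta.add ⟨1⟩ ⟨1⟩)) (𝟙 ⟨1⟩) ≫
        Delta.bang _)) (powMap_heq_of_terminal T rfl _ _) ?_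
      rw [powMap_comp]
      refine (heq_comp_comp ?_ (pow_add T ⟨1⟩ ⟨1⟩).symm rfl ?_ (eqToHom_comp_heq _ _)).symm
      · rw [pow_add, pow_add]
      · exact (heq_whiskerLeft rfl (pow_add T _ _).symm rfl (eqToHom_comp_heq _ _)).trans
          (powMap_addHom_id T _ ⟨1⟩).symm

lemma toMnd_η_heq : (toMnd T).η ≍ powMap T (Delta.bang ⟨0⟩) := eqToHom_comp_heq _ _

lemma toMnd_μ_heq : (toMnd T).μ ≍ powMap T (Delta.bang (Delta.add ⟨1⟩ ⟨1⟩)) :=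
  eqToHom_comp_heq _ _

end Powers

/-! ### Factorization in `Π_l` -/

namespace PiL

/-- A partial map to the empty order is nowhere defined, so `0` is terminal in `Π_l`. This is the
source of the algebra laws for cones. -/
instance (n : PiL) : Subsingleton (n ⟶ (⟨0⟩ : PiL)) :=
  ⟨fun f g => Hom.ext (funext fun i => by
    rcases h : f.fn i with _ | x
    · rcases h' : g.fn i with _ | y
      · rfl
      · exact y.elim0
    · exact x.elim0)⟩

lemma act_ext_lt {a b : PiL} {f g : a ⟶ b} (h : ∀ k < a.len, act f k = act g k) : f = g :=
  act_ext fun k => (lt_or_ge k a.len).elim (h k) fun hk => by rw [act_ge f hk, act_ge g hk]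

/-- The map from `n` to the zero object of `Π_l`. -/
def toZero (n : PiL) : n ⟶ (⟨0⟩ : PiL) := ⟨fun _ => none, by simp, by simp⟩

lemma act_toZero {n : PiL} (f : n ⟶ (⟨0⟩ : PiL)) (k : ℕ) :
    act f k = if k < n.len then none else some (k - n.len) := by
  rw [Subsingleton.elim f (toZero n)]
  split_ifs with h
  · simp [act, h, toZero]
  · simp [act, h]

/-- The total map that sends the elements on which `f` is not defined to an additional greatest
element. -/
def hat {n m : PiL} (f : n ⟶ m) : (⟨n.len⟩ : Delta) ⟶ (⟨m.len + 1⟩ : Delta) where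
  fn i := (f.fn i).elim (Fin.last _) Fin.castSucc
  mono i j h := by
    -- If `f` is not defined at `j`, the value there is the greatest element. Otherwise `f` is
    -- defined at `i` too, because its domain of definition is an initial segment.
    rcases hj : f.fn j with _ | y
    · simpa [hj] using Fin.le_last _
    · obtain ⟨x, hx⟩ := Option.isSome_iff_exists.1 (f.initial i j h (by simp [hj]))
      simpa [hx, hj] using f.mono i j h x hx y hj

lemma act_hat {n m : PiL} (f : n ⟶ m) (k : ℕ) : Delta.act (hat f) k =
    if k < n.len then (act f k).getD m.len else m.len + 1 + (k - n.len) := by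
  by_cases h : k < n.len
  · rw [if_pos h, Delta.act, dif_pos h, act_lt f h]
    cases hi : f.fn ⟨k, h⟩ <;> simp [hat, hi]
  · rw [if_neg h, Delta.act_ge _ (not_lt.1 h)]

lemma act_lt_of_mem {n m : PiL} (f : n ⟶ m) {k l : ℕ} (h : k < n.len) (hl : act f k = some l) :
    l < m.len := by
  rw [act_lt f h] at hl
  obtain ⟨x, -, rfl⟩ := Option.map_eq_some_iff.1 hl
  exact x.isLt

/-- The map that is not defined on the last element, and the identity elsewhere. -/
def dropLast (m : PiL) : (⟨m.len + 1⟩ : PiL) ⟶ m :=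
  addHom (b := ⟨m.len⟩) (d := ⟨0⟩) (𝟙 (⟨m.len⟩ : Delta)) (toZero ⟨1⟩)

/-- A monotone function as a map in `Π_l`. -/
def ofDelta {a b : Delta} (f : a ⟶ b) : (⟨a.len⟩ : PiL) ⟶ (⟨b.len⟩ : PiL) :=
  addHom f (𝟙 (⟨0⟩ : PiL))

/-- The additional element that `hat f` uses for "undefined" is the one on which `dropLast` is not
defined. A functor on `Π_l` is therefore controlled by its values on total maps and on the maps
`dropLast`. -/
lemma hat_fac {n m : PiL} (f : n ⟶ m) : f = ofDelta (hat f) ≫ dropLast m :=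
  act_ext_lt fun k h => by
    rw [act_comp, ofDelta, dropLast, act_addHom]
    simp only [h, if_true, Option.bind_some, act_addHom, act_hat, Delta.act_id, act_toZero]
    rcases hk : act f k with _ | l
    · simp
    · simp [act_lt_of_mem f h hk]

/-- The Kleisli identity: an everywhere defined identity becomes the inclusion `n ⟶ n + 1`, the unit
of the monad `(-) + 1` on `Δ`. -/
lemma hat_id (n : PiL) :
    hat (𝟙 n) = Delta.addHom (𝟙 (⟨n.len⟩ : Delta)) (Delta.bang ⟨0⟩) :=
  Delta.act_ext_lt fun k h => by
    rw [act_hat, Delta.act_addHom]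
    simp [show k < n.len from h]

/-- Kleisli composition for `(-) + 1`: in `p + 2` one additional element receives what `g` loses and
the other what `f` loses; the map `2 ⟶ 1` merges them. -/
lemma hat_comp {n m p : PiL} (f : n ⟶ m) (g : m ⟶ p) : hat (f ≫ g) =
    hat f ≫ CategoryStruct.comp (Z := ⟨p.len + 1⟩) (Delta.addHom (hat g) (𝟙 (⟨1⟩ : Delta)))
      (Delta.addHom (𝟙 (⟨p.len⟩ : Delta)) (Delta.bang (Delta.add ⟨1⟩ ⟨1⟩))) :=
  Delta.act_ext_lt fun k h => by
    replace h : k < n.len := h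
    have hb (x : ℕ) (hx : x < 2) : Delta.act (Delta.bang (Delta.add ⟨1⟩ ⟨1⟩)) x = 0 := by
      simp [Delta.act, hx, Delta.bang]
    simp only [Delta.act_comp, Delta.act_addHom, act_hat, Delta.act_id, act_comp, h, if_true]
    rcases hk : act f k with _ | l
    · simp [hb]
    · have hl := act_lt_of_mem f h hk
      simp only [Option.bind_some, Option.getD_some, hl, if_true]
      rcases hk' : act g l with _ | l'
      · simp [hb]
      · simp [act_lt_of_mem g hl hk']

lemma hat_id_addHom (n : Delta) {k k' : PiL} (g : k ⟶ k') :
    hat (addHom (𝟙 n) g) = Delta.addHom (𝟙 n) (hat g) :=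
  Delta.act_ext_lt fun x hx => by
    replace hx : x < n.len + k.len := hx
    rw [act_hat, Delta.act_addHom, act_addHom, act_hat]
    by_cases h : x < n.len
    · simp [h, hx]
    · simp only [h, hx, show x - n.len < k.len by omega, if_true, if_false]
      rcases act g (x - n.len) <;> simp

/-- A total map never takes the additional value, so its `hat` passes through the inclusion `hat (𝟙
_)`. On such maps the action of an algebra will cancel against the unit. -/
lemma hat_addHom_id {n n' : Delta} (f : n ⟶ n') (k : PiL) : hat (addHom f (𝟙 k)) =
    CategoryStruct.comp (Y := Delta.add n' ⟨k.len⟩) (Delta.addHom f (𝟙 (⟨k.len⟩ : Delta)))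
      (hat (𝟙 (add n' k))) :=
  Delta.act_ext_lt fun x hx => by
    replace hx : x < n.len + k.len := hx
    rw [act_hat, Delta.act_comp, Delta.act_addHom, act_addHom, act_hat, act_id]
    by_cases h : x < n.len
    · have := Delta.act_lt f h
      simp [h, hx, show Delta.act f x < n'.len + k.len by omega]
    · simp [h, hx, show x - n.len < k.len by omega]

end PiL

/-! ### Lax morphisms from identity monads as algebras -/

namespace Mnd

variable {D : Type u} [Bicategory.{w, v} D]

lemma laxHom_ext {S T : Mnd D} {P Q : LaxHom S T} (hF : P.F = Q.F) (hφ : P.φ ≍ Q.φ) : P = Q := by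
  obtain ⟨F, φ, _, _⟩ := P
  obtain ⟨F', φ', _, _⟩ := Q
  obtain rfl : F = F' := hF
  obtain rfl : φ = φ' := eq_of_heq hφ
  rfl

lemma trans_heq {S T : Mnd D} {P Q P' Q' : S ⟶ T} {a : P ⟶ Q} {b : P' ⟶ Q'} (hP : P = P')
    (hQ : Q = Q') (h : LaxHom.Trans.σ a ≍ LaxHom.Trans.σ b) : a ≍ b := by
  subst hP hQ
  exact heq_of_eq (hom₂_ext (eq_of_heq h))

variable [Strict D] {X : D} {M : Mnd D}

/-- With the identity monad as source, the unit axiom of a lax morphism contains only unitors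
besides `T.η` and `φ`, and so becomes the unit law of an algebra. -/
lemma idMonad_unit_eq {Y : D} (F : X ⟶ Y) : (ρ_ F).hom ≫ (λ_ F).inv ≫ 𝟙 (𝟙 X) ▷ F =
    eqToHom ((Strict.comp_id F).trans (Strict.id_comp F).symm) := by
  simp [Strict.leftUnitor_eqToIso, Strict.rightUnitor_eqToIso]

/-- Likewise the multiplication of the identity monad is a unitor, so what remains of this axiom is
the associative law of an algebra. -/
lemma idMonad_mul_eq {Y : D} {F : X ⟶ Y} {t : Y ⟶ Y} (a : F ≫ t ⟶ F) :
    (α_ F t t).inv ≫ (a ≫ eqToHom (Strict.id_comp F).symm) ▷ t ≫ (α_ (𝟙 X) F t).hom ≫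
      𝟙 X ◁ (a ≫ eqToHom (Strict.id_comp F).symm) ≫ (α_ (𝟙 X) (𝟙 X) F).inv ≫
        (λ_ (𝟙 X)).hom ▷ F =
    eqToHom (Strict.assoc F t t).symm ≫ (a ▷ t ≫ a) ≫ eqToHom (Strict.id_comp F).symm := by
  simp [Strict.leftUnitor_eqToIso, Strict.associator_eqToIso]

/-- The lax morphism from an identity monad that is given by an algebra. -/
@[simps]
def LaxHom.ofAction (F : X ⟶ M.obj) (a : F ≫ M.t ⟶ F) (unit : F ◁ M.η ≫ a ≍ 𝟙 F)
    (mul : F ◁ M.μ ≫ a ≍ a ▷ M.t ≫ a) : LaxHom (idMonad X) M where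
  F := F
  φ := a ≫ eqToHom (Strict.id_comp F).symm
  unit := by
    dsimp only [idMonad]
    rw [idMonad_unit_eq]
    refine eq_of_heq (HEq.trans ?_ (eqToHom_heq_id_cod _ _ _).symm)
    refine HEq.trans ?_ (unit.trans (heq_id (Strict.id_comp F).symm))
    exact heq_comp_comp rfl rfl (Strict.id_comp F) HEq.rfl (comp_eqToHom_heq _ _)
  mul := by
    dsimp only [idMonad]
    rw [idMonad_mul_eq]
    refine eq_of_heq (HEq.trans ?_ (heq_conj _ _ _).symm)
    exact (heq_comp_comp rfl rfl (Strict.id_comp F) HEq.rfl (comp_eqToHom_heq _ _)).trans mul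

namespace LaxHom

variable (P : LaxHom (idMonad X) M)

/-- The action that corresponds to a lax morphism from an identity monad. -/
def action : P.F ≫ M.t ⟶ P.F := P.φ ≫ eqToHom (Strict.id_comp P.F)

lemma φ_eq : P.φ = P.action ≫ eqToHom (Strict.id_comp P.F).symm := by
  simp [action]

lemma action_heq : P.action ≍ P.φ := comp_eqToHom_heq _ _

lemma action_unit : P.F ◁ M.η ≫ P.action ≍ 𝟙 P.F := by
  refine (heq_comp_comp rfl rfl (Strict.id_comp P.F).symm HEq.rfl P.action_heq).trans ?_
  rw [P.unit]
  dsimp only [idMonad]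
  rw [idMonad_unit_eq]
  exact (eqToHom_heq_id_cod _ _ _).trans (heq_id (Strict.id_comp P.F))

lemma action_mul : P.F ◁ M.μ ≫ P.action ≍ P.action ▷ M.t ≫ P.action := by
  refine (heq_comp_comp rfl rfl (Strict.id_comp P.F).symm HEq.rfl P.action_heq).trans ?_
  rw [P.mul, P.φ_eq]
  dsimp only [idMonad]
  rw [idMonad_mul_eq]
  exact heq_conj _ _ _

end LaxHom

variable {P Q : LaxHom (idMonad X) M}

lemma trans_comm (a : LaxHom.Trans P Q) : a.σ ▷ M.t ≫ Q.action = P.action ≫ a.σ := by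
  have h := congrArg (· ≫ eqToHom (Strict.id_comp Q.F)) a.comm
  simp only [Category.assoc] at h
  refine h.trans (eq_of_heq ?_)
  rw [LaxHom.action, Category.assoc]
  refine heq_comp_comp rfl rfl rfl HEq.rfl ?_
  refine (comp_eqToHom_heq _ _).trans ((id_whiskerLeft_heq _).trans (eqToHom_comp_heq _ _).symm)

/-- The transformation that is given by a morphism of algebras. -/
@[simps]
def transOfAction (σ : P.F ⟶ Q.F) (h : σ ▷ M.t ≫ Q.action = P.action ≫ σ) :
    LaxHom.Trans P Q where
  σ := σ
  comm := by
    rw [P.φ_eq, Q.φ_eq, reassoc_of% h, Category.assoc]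
    refine congrArg (P.action ≫ ·) (eq_of_heq ?_)
    exact (comp_eqToHom_heq _ _).trans
      ((id_whiskerLeft_heq _).symm.trans (eqToHom_comp_heq _ _).symm)

end Mnd

/-! ### `W_l`-cones as algebras -/

section Cones

variable {D : Type u} [Bicategory.{w, v} D] [Strict D] {T : StrictPseudofunctor BDelta D} {X : D}

namespace WlCone

/-- The underlying functor of a `W_l`-cone. -/
def toFunctor (l : CatTrans Wl (homFromComp X T)) : PiL ⥤ (X ⟶ base T) := l.app BDelta.pt

section

variable (l : CatTrans Wl (homFromComp X T))

lemma obj_add (n : Delta) (k : PiL) :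
    (toFunctor l).obj (PiL.add n k) = (toFunctor l).obj k ≫ pow T n :=
  Functor.congr_obj (l.naturality (i := BDelta.pt) (j := BDelta.pt) n) k

/-- Here `k` is `k + 0`, so naturality determines all objects of a cone from its value at `0`. -/
lemma obj_eq (k : PiL) : (toFunctor l).obj k = (toFunctor l).obj ⟨0⟩ ≫ pow T ⟨k.len⟩ :=
  obj_add l ⟨k.len⟩ ⟨0⟩

lemma map_id_addHom (n : Delta) {k k' : PiL} (g : k ⟶ k') :
    (toFunctor l).map (PiL.addHom (𝟙 n) g) ≍ (toFunctor l).map g ▷ pow T n :=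
  (heq_of_eq (l.naturality_map (i := BDelta.pt) (j := BDelta.pt) n g)).trans (heq_conj _ _ _)

lemma map_addHom_id {n n' : Delta} (f : n ⟶ n') (k : PiL) :
    (toFunctor l).map (PiL.addHom f (𝟙 k)) ≍ (toFunctor l).obj k ◁ powMap T f :=
  (heq_of_eq (l.naturality₂_app (i := BDelta.pt) (j := BDelta.pt) f k)).trans (heq_conj _ _ _)

lemma map_dropLast (m : PiL) : (toFunctor l).map (PiL.dropLast m) ≍
    (toFunctor l).map (PiL.toZero ⟨1⟩) ▷ pow T ⟨m.len⟩ :=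
  map_id_addHom l ⟨m.len⟩ (PiL.toZero ⟨1⟩)

lemma map_ofDelta {n n' : Delta} (f : n ⟶ n') :
    (toFunctor l).map (PiL.ofDelta f) ≍ (toFunctor l).obj ⟨0⟩ ◁ powMap T f :=
  map_addHom_id l f ⟨0⟩

end

variable {l l' : CatTrans Wl (homFromComp X T)}

lemma cone_ext (h : toFunctor l = toFunctor l') : l = l' :=
  CatTrans.ext (funext fun _ => h)

/-- By `PiL.hat_fac` it is enough to compare the cones on total maps, where the value at `0`
decides, and on `dropLast m`, which is `m + (1 ⟶ 0)`. -/
lemma cone_ext_of_action (h : (toFunctor l).obj ⟨0⟩ = (toFunctor l').obj ⟨0⟩)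
    (h' : (toFunctor l).map (PiL.toZero ⟨1⟩) ≍ (toFunctor l').map (PiL.toZero ⟨1⟩)) : l = l' := by
  have ho (k : PiL) : (toFunctor l).obj k = (toFunctor l').obj k := by
    rw [obj_eq, obj_eq l', h]
  refine cone_ext (Functor.hext ho fun n m f => ?_)
  rw [PiL.hat_fac f, Functor.map_comp, Functor.map_comp]
  refine heq_comp_comp (ho _) (ho _) (ho _) ?_ ?_
  · exact (map_ofDelta l _).trans
      ((heq_whiskerLeft h rfl rfl HEq.rfl).trans (map_ofDelta l' _).symm)
  · exact (map_dropLast l m).trans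
      ((heq_whiskerRight (ho ⟨1⟩) h rfl h').trans (map_dropLast l' m).symm)

/-- The component of a modification of `W_l`-cones at the only 0-cell. -/
def toNatTrans (a : l ⟶ l') : toFunctor l ⟶ toFunctor l' := CatTrans.Modif.app a BDelta.pt

lemma toNatTrans_app_add (a : l ⟶ l') (n : Delta) (k : PiL) :
    (toNatTrans a).app (PiL.add n k) ≍ (toNatTrans a).app k ▷ pow T n :=
  (heq_of_eq (CatTrans.Modif.naturality_app a (i := BDelta.pt) (j := BDelta.pt) n k)).trans
    (heq_conj _ _ _)

/-- The component at `k = k + 0` is the component at `0` whiskered with `T k`. -/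
lemma modif_ext_zero {a b : l ⟶ l'} (h : (toNatTrans a).app ⟨0⟩ = (toNatTrans b).app ⟨0⟩) :
    a = b :=
  CatTrans.modif_ext fun _ k => eq_of_heq ((toNatTrans_app_add a ⟨PiL.len k⟩ ⟨0⟩).trans
    ((heq_of_eq (by rw [h])).trans (toNatTrans_app_add b ⟨PiL.len k⟩ ⟨0⟩).symm))

/-- A `W_l`-cone from a functor on `Π_l`. -/
def ofFunctor (L : PiL ⥤ (X ⟶ base T))
    (obj_add : ∀ n k, L.obj (PiL.add n k) = L.obj k ≫ pow T n)
    (map_left : ∀ (n : Delta) {k k' : PiL} (g : k ⟶ k'),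
      L.map (PiL.addHom (𝟙 n) g) ≍ L.map g ▷ pow T n)
    (map_right : ∀ {n n' : Delta} (f : n ⟶ n') (k : PiL),
      L.map (PiL.addHom f (𝟙 k)) ≍ L.obj k ◁ powMap T f) :
    CatTrans Wl (homFromComp X T) where
  app _ := L
  naturality n := CategoryTheory.Functor.ext (obj_add n) fun _ _ g =>
    eq_conj_of_heq (obj_add n _) (obj_add n _).symm (map_left n g)
  naturality₂ {_ _ n n'} f := natTrans_conj_ext _ _ fun k =>
    eq_conj_of_heq (obj_add n k) (obj_add n' k).symm (map_right f k)

/-- The cells `A ≫ T (m + 1) ⟶ A ≫ T m` that are given by an algebra `A`. -/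
def actPow {A : X ⟶ base T} (a : A ≫ pow T ⟨1⟩ ⟶ A) (m : ℕ) :
    A ≫ pow T ⟨m + 1⟩ ⟶ A ≫ pow T ⟨m⟩ :=
  eqToHom ((congrArg (A ≫ ·) (pow_add T ⟨m⟩ ⟨1⟩)).trans (Strict.assoc _ _ _).symm) ≫ a ▷ pow T ⟨m⟩

lemma actPow_heq {A : X ⟶ base T} (a : A ≫ pow T ⟨1⟩ ⟶ A) (m : ℕ) :
    actPow a m ≍ a ▷ pow T ⟨m⟩ := eqToHom_comp_heq _ _

section OfAction

variable {A : X ⟶ base T} (a : A ≫ pow T ⟨1⟩ ⟶ A)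

lemma comp_pow_add (A : X ⟶ base T) (n m : Delta) :
    A ≫ pow T (Delta.add n m) = (A ≫ pow T m) ≫ pow T n := by
  rw [pow_add, Strict.assoc]

lemma comp_pow_zero (A : X ⟶ base T) : A ≫ pow T ⟨0⟩ = A := by rw [pow_zero, Strict.comp_id]

lemma whiskerLeft_powMap_id_addHom {m m' : Delta} (f : m ⟶ m') (n : Delta) :
    A ◁ powMap T (Delta.addHom (𝟙 n) f) ≍ (A ◁ powMap T f) ▷ pow T n :=
  (heq_whiskerLeft rfl (pow_add T _ _) (pow_add T _ _) (powMap_id_addHom T f n)).trans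
    (whisker_assoc_heq _ _ _).symm

lemma whiskerLeft_powMap_addHom_id {n n' : Delta} (f : n ⟶ n') (m : Delta) :
    A ◁ powMap T (Delta.addHom f (𝟙 m)) ≍ (A ≫ pow T m) ◁ powMap T f :=
  (heq_whiskerLeft rfl (pow_add T _ _) (pow_add T _ _) (powMap_addHom_id T f m)).trans
    (comp_whiskerLeft_heq _ _ _).symm

/-- The unit law of the algebra whiskered with `T m`; it is what preservation of identities needs
after `PiL.hat_id`. -/
lemma actPow_unit (unit : A ◁ (toMnd T).η ≫ a ≍ 𝟙 A) (m : ℕ) :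
    A ◁ powMap T (Delta.addHom (𝟙 (⟨m⟩ : Delta)) (Delta.bang ⟨0⟩)) ≫ actPow a m =
      𝟙 (A ≫ pow T ⟨m⟩) := eq_of_heq <| by
  refine (heq_comp_comp (comp_pow_add A ⟨m⟩ ⟨0⟩) (comp_pow_add A ⟨m⟩ ⟨1⟩) rfl
    (whiskerLeft_powMap_id_addHom _ _) (actPow_heq a m)).trans ?_
  rw [← comp_whiskerRight]
  refine (heq_whiskerRight (comp_pow_zero A) rfl rfl ?_).trans (heq_of_eq (id_whiskerRight _ _))
  exact (heq_comp_comp (congrArg (A ≫ ·) (pow_zero T)) rfl rfl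
    (heq_whiskerLeft rfl (pow_zero T) rfl (toMnd_η_heq T).symm) HEq.rfl).trans unit

/-- The associative law whiskered with `T m`; it turns the merging map of `PiL.hat_comp` into two
consecutive actions. -/
lemma actPow_mul (mul : A ◁ (toMnd T).μ ≫ a ≍ a ▷ (toMnd T).t ≫ a) (m : ℕ) :
    A ◁ powMap T (Delta.addHom (𝟙 (⟨m⟩ : Delta)) (Delta.bang (Delta.add ⟨1⟩ ⟨1⟩))) ≫ actPow a m =
      actPow a (m + 1) ≫ actPow a m := eq_of_heq <| by
  refine (heq_comp_comp (comp_pow_add A ⟨m⟩ ⟨2⟩) (comp_pow_add A ⟨m⟩ ⟨1⟩) rfl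
    (whiskerLeft_powMap_id_addHom _ _) (actPow_heq a m)).trans ?_
  rw [← comp_whiskerRight]
  refine HEq.trans (b := (a ▷ pow T ⟨1⟩ ≫ a) ▷ pow T ⟨m⟩) ?_ ?_
  · refine heq_whiskerRight (comp_pow_add A ⟨1⟩ ⟨1⟩) rfl rfl ?_
    exact (heq_comp_comp (congrArg (A ≫ ·) (pow_add T ⟨1⟩ ⟨1⟩)) rfl rfl
      (heq_whiskerLeft rfl (pow_add T ⟨1⟩ ⟨1⟩) rfl (toMnd_μ_heq T).symm) HEq.rfl).trans mul
  · rw [comp_whiskerRight]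
    refine heq_comp_comp ?_ (comp_pow_add A ⟨m⟩ ⟨1⟩).symm rfl ?_ (actPow_heq a m).symm
    · rw [comp_pow_add A ⟨m + 1⟩ ⟨1⟩, Strict.assoc]
      exact congrArg (_ ≫ ·) (pow_add T ⟨m⟩ ⟨1⟩).symm
    · refine (whiskerRight_comp_heq _ _ _).symm.trans (HEq.trans ?_ (actPow_heq a (m + 1)).symm)
      exact heq_whiskerRight rfl rfl (pow_add T ⟨m⟩ ⟨1⟩).symm HEq.rfl

/-- The interchange law: the action concerns only the factor `T 1` next to `A`, and `g` only the
remaining factors. -/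
lemma actPow_exchange {m p : ℕ} (g : (⟨m⟩ : Delta) ⟶ ⟨p⟩) :
    actPow a m ≫ A ◁ powMap T g =
      A ◁ powMap T (Delta.addHom g (𝟙 (⟨1⟩ : Delta))) ≫ actPow a p := eq_of_heq <| by
  refine (heq_comp_comp (comp_pow_add A ⟨m⟩ ⟨1⟩) rfl rfl (actPow_heq a m) HEq.rfl).trans ?_
  rw [← whisker_exchange]
  exact (heq_comp_comp (comp_pow_add A ⟨m⟩ ⟨1⟩) (comp_pow_add A ⟨p⟩ ⟨1⟩) rfl
    (whiskerLeft_powMap_addHom_id g ⟨1⟩) (actPow_heq a p)).symm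

/-- The functor on `Π_l` that is given by an algebra. -/
@[simps]
def functorOfAction (unit : A ◁ (toMnd T).η ≫ a ≍ 𝟙 A)
    (mul : A ◁ (toMnd T).μ ≫ a ≍ a ▷ (toMnd T).t ≫ a) : PiL ⥤ (X ⟶ base T) where
  obj k := A ≫ pow T ⟨k.len⟩
  map {_ m} f := A ◁ powMap T (PiL.hat f) ≫ actPow a m.len
  map_id k := by rw [PiL.hat_id]; exact actPow_unit a unit k.len
  map_comp {n m p} f g := by
    -- `hat g` is moved in front of the first action; the two actions then meet and are replaced by
    -- the multiplication followed by one action, as in `PiL.hat_comp`.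
    rw [Category.assoc, ← Category.assoc (actPow a m.len), actPow_exchange, Category.assoc,
      ← actPow_mul a mul, PiL.hat_comp, powMap_comp, powMap_comp, whiskerLeft_comp,
      whiskerLeft_comp, Category.assoc, Category.assoc]

/-- The `W_l`-cone that is given by an algebra. -/
def ofAction (unit : A ◁ (toMnd T).η ≫ a ≍ 𝟙 A)
    (mul : A ◁ (toMnd T).μ ≫ a ≍ a ▷ (toMnd T).t ≫ a) : CatTrans Wl (homFromComp X T) :=
  ofFunctor (functorOfAction a unit mul) (fun n k => comp_pow_add A n ⟨k.len⟩)
    (fun n k k' g => by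
      refine HEq.trans (b := (A ◁ powMap T (PiL.hat g)) ▷ pow T n ≫ actPow a k'.len ▷ pow T n) ?_
        (heq_of_eq (comp_whiskerRight _ _ _).symm)
      have h := whiskerLeft_powMap_id_addHom (A := A) (PiL.hat g) n
      rw [← PiL.hat_id_addHom] at h
      refine heq_comp_comp (comp_pow_add A n ⟨k.len⟩) (comp_pow_add A n ⟨k'.len + 1⟩)
        (comp_pow_add A n ⟨k'.len⟩) h ?_
      refine (actPow_heq a _).trans ?_
      refine (heq_whiskerRight rfl rfl (pow_add T n ⟨k'.len⟩) HEq.rfl).trans ?_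
      refine (whiskerRight_comp_heq _ _ _).trans ?_
      exact heq_whiskerRight (comp_pow_add A ⟨k'.len⟩ ⟨1⟩).symm rfl rfl (actPow_heq a _).symm)
    (fun {n n'} f k => by
      -- The map `f + k` is total, so the action meets a unit and cancels.
      have h' : (functorOfAction a unit mul).map (PiL.addHom f (𝟙 k)) =
          A ◁ powMap T (Delta.addHom f (𝟙 (⟨k.len⟩ : Delta))) := by
        rw [functorOfAction_map, PiL.hat_addHom_id, powMap_comp, whiskerLeft_comp, Category.assoc,
          PiL.hat_id]
        exact (congrArg _ (actPow_unit a unit _)).trans (Category.comp_id _)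
      rw [h']
      exact whiskerLeft_powMap_addHom_id f ⟨k.len⟩)

end OfAction

end WlCone

end Cones

/-! ### The 2-natural isomorphism between cones and algebras -/

section Cones

variable {D : Type u} [Bicategory.{w, v} D] [Strict D] {T : StrictPseudofunctor BDelta D} {X : D}

namespace Mnd.LaxHom

@[simp] lemma ofAction_action {M : Mnd D} (F : X ⟶ M.obj) (a : F ≫ M.t ⟶ F)
    (unit : F ◁ M.η ≫ a ≍ 𝟙 F) (mul : F ◁ M.μ ≫ a ≍ a ▷ M.t ≫ a) :
    (ofAction F a unit mul).action = a :=
  eq_of_heq ((action_heq _).trans (comp_eqToHom_heq _ _))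

end Mnd.LaxHom

/-- The 2-cell of `idLaxHom f` is a composite of unitors, so precomposition with `ι f` only whiskers
the action with `f`. -/
lemma Mnd.ι_comp_φ_heq {Y : D} (f : X ⟶ Y) {M : Mnd D} (P : Mnd.LaxHom (Mnd.idMonad Y) M) :
    ((Mnd.LaxHom.comp (Mnd.idLaxHom f) P)).φ ≍ f ◁ P.action := by
  dsimp only [Mnd.LaxHom.comp, Mnd.idLaxHom, Mnd.idMonad]
  rw [P.φ_eq]
  simp only [Strict.associator_eqToIso, Strict.leftUnitor_eqToIso, Strict.rightUnitor_eqToIso,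
    eqToIso.hom, eqToIso.inv, eqToHom_whiskerRight, whiskerLeft_comp, whiskerLeft_eqToHom,
    Category.assoc, eqToHom_trans]
  exact heq_conj _ _ _

namespace WlCone

/-- The `hat` of `1 ⟶ 0` is the identity of `1`, so only the action itself remains. Thus the cone of
an algebra returns the algebra. -/
lemma functorOfAction_map_toZero {A : X ⟶ base T} (a : A ≫ pow T ⟨1⟩ ⟶ A)
    (unit : A ◁ (toMnd T).η ≫ a ≍ 𝟙 A) (mul : A ◁ (toMnd T).μ ≫ a ≍ a ▷ (toMnd T).t ≫ a) :
    (functorOfAction a unit mul).map (PiL.toZero ⟨1⟩) ≍ a := by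
  have h : PiL.hat (PiL.toZero ⟨1⟩) = 𝟙 (⟨1⟩ : Delta) :=
    Subsingleton.elim (α := (⟨1⟩ : Delta) ⟶ ⟨1⟩) _ _
  have e : (functorOfAction a unit mul).map (PiL.toZero ⟨1⟩) = actPow a 0 := by
    rw [functorOfAction_map, h, powMap_id, whiskerLeft_id]
    exact Category.id_comp _
  exact (heq_of_eq e).trans <| (actPow_heq a 0).trans <|
    (heq_whiskerRight rfl rfl (pow_zero T) HEq.rfl).trans (whiskerRight_id_heq a)

variable (l : CatTrans Wl (homFromComp X T))

/-- The action of the algebra that underlies a `W_l`-cone. -/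
def action : (toFunctor l).obj ⟨0⟩ ≫ pow T ⟨1⟩ ⟶ (toFunctor l).obj ⟨0⟩ :=
  eqToHom (obj_add l ⟨1⟩ ⟨0⟩).symm ≫ (toFunctor l).map (PiL.toZero ⟨1⟩)

lemma action_heq : action l ≍ (toFunctor l).map (PiL.toZero ⟨1⟩) := eqToHom_comp_heq _ _

/-- The composite `0 ⟶ 1 ⟶ 0` in `Π_l` is the identity. -/
lemma action_unit : (toFunctor l).obj ⟨0⟩ ◁ (toMnd T).η ≫ action l ≍ 𝟙 ((toFunctor l).obj ⟨0⟩) := by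
  refine HEq.trans (b := (toFunctor l).map (PiL.ofDelta (Delta.bang ⟨0⟩) ≫ PiL.toZero ⟨1⟩)) ?_ ?_
  · rw [Functor.map_comp]
    refine heq_comp_comp ?_ (obj_add l ⟨1⟩ ⟨0⟩).symm rfl ?_ (action_heq l)
    · exact Strict.comp_id _
    · exact (heq_whiskerLeft rfl (pow_zero T).symm rfl (toMnd_η_heq T)).trans
        (map_ofDelta l _).symm
  · rw [Subsingleton.elim (PiL.ofDelta (Delta.bang ⟨0⟩) ≫ PiL.toZero ⟨1⟩) (𝟙 _)]
    exact heq_of_eq ((toFunctor l).map_id _)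

/-- The map `2 ⟶ 0` can be obtained by merging the two elements and then dropping the result, or by
dropping them one at a time, the last one first. The images of the two composites are the two sides
of the law. -/
lemma action_mul : (toFunctor l).obj ⟨0⟩ ◁ (toMnd T).μ ≫ action l ≍
    action l ▷ (toMnd T).t ≫ action l := by
  refine HEq.trans (b := (toFunctor l).map (PiL.ofDelta (Delta.bang ⟨2⟩) ≫ PiL.toZero ⟨1⟩)) ?_ ?_
  · rw [Functor.map_comp]
    refine heq_comp_comp ?_ (obj_add l ⟨1⟩ ⟨0⟩).symm rfl ?_ (action_heq l)
    · exact (congrArg (_ ≫ ·) (pow_add T ⟨1⟩ ⟨1⟩)).symm.trans (obj_add l ⟨2⟩ ⟨0⟩).symm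
    · exact (heq_whiskerLeft rfl (pow_add T ⟨1⟩ ⟨1⟩).symm rfl (toMnd_μ_heq T)).trans
        (map_ofDelta l _).symm
  · rw [Subsingleton.elim (PiL.ofDelta (Delta.bang ⟨2⟩) ≫ PiL.toZero ⟨1⟩)
      (PiL.dropLast ⟨1⟩ ≫ PiL.toZero ⟨1⟩), Functor.map_comp]
    refine heq_comp_comp ?_ (obj_add l ⟨1⟩ ⟨0⟩) rfl ?_ (action_heq l).symm
    · exact (obj_add l ⟨1⟩ ⟨1⟩).trans (congrArg (· ≫ pow T ⟨1⟩) (obj_add l ⟨1⟩ ⟨0⟩))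
    · exact (map_dropLast l ⟨1⟩).trans
        (heq_whiskerRight (obj_add l ⟨1⟩ ⟨0⟩) rfl rfl (action_heq l).symm)

/-- The algebra that underlies a `W_l`-cone, as a lax morphism. -/
def laxHom : (Mnd.idMonad X : Mnd D) ⟶ toMnd T :=
  Mnd.LaxHom.ofAction (M := toMnd T) ((toFunctor l).obj ⟨0⟩) (action l) (action_unit l)
    (action_mul l)

lemma laxHom_action : (laxHom l).action = action l := Mnd.LaxHom.ofAction_action _ _ _ _

variable {l} {l' l'' : CatTrans Wl (homFromComp X T)}

/-- This is naturality of the modification's component at the map `1 ⟶ 0` of `Π_l`. -/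
lemma toNatTrans_comm (a : l ⟶ l') : (toNatTrans a).app ⟨0⟩ ▷ pow T ⟨1⟩ ≫ action l' =
    action l ≫ (toNatTrans a).app ⟨0⟩ := eq_of_heq <| by
  refine HEq.trans (b := (toNatTrans a).app ⟨1⟩ ≫ (toFunctor l').map (PiL.toZero ⟨1⟩)) ?_ ?_
  · exact heq_comp_comp (obj_add l ⟨1⟩ ⟨0⟩).symm (obj_add l' ⟨1⟩ ⟨0⟩).symm rfl
      (toNatTrans_app_add a ⟨1⟩ ⟨0⟩).symm (action_heq l')
  · rw [← NatTrans.naturality]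
    exact heq_comp_comp (obj_add l ⟨1⟩ ⟨0⟩) rfl rfl (action_heq l).symm HEq.rfl

/-- The morphism of algebras that underlies a modification of `W_l`-cones. -/
def trans (a : l ⟶ l') : laxHom l ⟶ laxHom l' :=
  Mnd.transOfAction ((toNatTrans a).app ⟨0⟩) (by
    rw [laxHom_action, laxHom_action]
    exact toNatTrans_comm a)

variable (T X) in
/-- The functor from `W_l`-cones to algebras. -/
@[simps]
def toAlgebra : CatTrans Wl (homFromComp X T) ⥤ ((Mnd.idMonad X : Mnd D) ⟶ toMnd T) where
  obj l := laxHom l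
  map a := trans a

lemma toAlgebra_obj_injective : Function.Injective (toAlgebra T X).obj := fun l l' h => by
  have h₁ : (toFunctor l).obj ⟨0⟩ = (toFunctor l').obj ⟨0⟩ := congrArg Mnd.LaxHom.F h
  have h₂ : (laxHom l).action ≍ (laxHom l').action := by
    rw [show laxHom l = laxHom l' from h]
  rw [laxHom_action, laxHom_action] at h₂
  exact cone_ext_of_action h₁ ((action_heq l).symm.trans (h₂.trans (action_heq l')))

lemma toAlgebra_obj_surjective : Function.Surjective (toAlgebra T X).obj := fun P => by
  -- The cone takes the value `P.F ≫ T 0` at `0`. This equals `P.F` only propositionally, so the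
  -- 2-cells are compared heterogeneously.
  refine ⟨ofAction (T := T) (Mnd.LaxHom.action P) P.action_unit P.action_mul,
    Mnd.laxHom_ext (comp_pow_zero _) ?_⟩
  refine HEq.trans ?_ (Mnd.LaxHom.action_heq P)
  refine (Mnd.LaxHom.action_heq _).symm.trans ?_
  refine (heq_of_eq (laxHom_action _)).trans ?_
  refine (action_heq _).trans ?_
  exact functorOfAction_map_toZero (T := T) (A := P.F) P.action P.action_unit P.action_mul

lemma toAlgebra_map_injective :
    Function.Injective ((toAlgebra T X).map : (l ⟶ l') → (laxHom l ⟶ laxHom l')) :=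
  fun _ _ h => modif_ext_zero (congrArg Mnd.LaxHom.Trans.σ h)

/-- The component of the modification of `W_l`-cones that is given by a morphism of algebras. -/
def modifApp (σ : (toFunctor l).obj ⟨0⟩ ⟶ (toFunctor l').obj ⟨0⟩) (k : PiL) :
    (toFunctor l).obj k ⟶ (toFunctor l').obj k :=
  eqToHom (obj_eq l k) ≫ σ ▷ pow T ⟨k.len⟩ ≫ eqToHom (obj_eq l' k).symm

lemma modifApp_heq (σ : (toFunctor l).obj ⟨0⟩ ⟶ (toFunctor l').obj ⟨0⟩) (k : PiL) :
    modifApp σ k ≍ σ ▷ pow T ⟨k.len⟩ := heq_conj _ _ _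

lemma modifApp_zero (σ : (toFunctor l).obj ⟨0⟩ ⟶ (toFunctor l').obj ⟨0⟩) :
    modifApp σ ⟨0⟩ = σ :=
  eq_of_heq ((modifApp_heq σ ⟨0⟩).trans
    ((heq_whiskerRight rfl rfl (pow_zero T) HEq.rfl).trans (whiskerRight_id_heq σ)))

lemma modifApp_add (σ : (toFunctor l).obj ⟨0⟩ ⟶ (toFunctor l').obj ⟨0⟩) (n : Delta) (k : PiL) :
    modifApp σ (PiL.add n k) ≍ modifApp σ k ▷ pow T n :=
  (modifApp_heq σ _).trans <| (heq_whiskerRight rfl rfl (pow_add T n ⟨k.len⟩) HEq.rfl).trans <|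
    (whiskerRight_comp_heq _ _ _).trans
      (heq_whiskerRight (obj_eq l k).symm (obj_eq l' k).symm rfl (modifApp_heq σ k).symm)

/-- On total maps naturality is the interchange law and needs no compatibility of `σ` with the
actions. -/
lemma modifApp_ofDelta (σ : (toFunctor l).obj ⟨0⟩ ⟶ (toFunctor l').obj ⟨0⟩) {n n' : Delta}
    (f : n ⟶ n') : (toFunctor l).map (PiL.ofDelta f) ≫ modifApp σ ⟨n'.len⟩ =
      modifApp σ ⟨n.len⟩ ≫ (toFunctor l').map (PiL.ofDelta f) := eq_of_heq <|
  (heq_comp_comp (obj_eq l ⟨n.len⟩) (obj_eq l ⟨n'.len⟩) (obj_eq l' ⟨n'.len⟩) (map_ofDelta l f)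
    (modifApp_heq σ _)).trans <| (heq_of_eq (whisker_exchange _ _)).trans
  (heq_comp_comp (obj_eq l ⟨n.len⟩) (obj_eq l' ⟨n.len⟩) (obj_eq l' ⟨n'.len⟩) (modifApp_heq σ _)
    (map_ofDelta l' f)).symm

/-- On `dropLast m` naturality is the equation of a morphism of algebras whiskered with `T m`. With
`PiL.hat_fac` this settles all maps of `Π_l`. -/
lemma modifApp_dropLast {σ : (toFunctor l).obj ⟨0⟩ ⟶ (toFunctor l').obj ⟨0⟩}
    (h : σ ▷ pow T ⟨1⟩ ≫ action l' = action l ≫ σ) (m : PiL) :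
    (toFunctor l).map (PiL.dropLast m) ≫ modifApp σ m =
      modifApp σ ⟨m.len + 1⟩ ≫ (toFunctor l').map (PiL.dropLast m) := eq_of_heq <| by
  have h₁ (l : CatTrans Wl (homFromComp X T)) :
      (toFunctor l).map (PiL.dropLast m) ≍ action l ▷ pow T ⟨m.len⟩ :=
    (map_dropLast l m).trans (heq_whiskerRight (obj_add l ⟨1⟩ ⟨0⟩) rfl rfl (action_heq l).symm)
  have h₂ (l : CatTrans Wl (homFromComp X T)) : (toFunctor l).obj ⟨m.len + 1⟩ =
      ((toFunctor l).obj ⟨0⟩ ≫ pow T ⟨1⟩) ≫ pow T ⟨m.len⟩ :=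
    (obj_add l ⟨m.len⟩ ⟨1⟩).trans (congrArg (· ≫ _) (obj_add l ⟨1⟩ ⟨0⟩))
  refine (heq_comp_comp (h₂ l) (obj_eq l m) (obj_eq l' m) (h₁ l) (modifApp_heq σ m)).trans ?_
  rw [← comp_whiskerRight, ← h, comp_whiskerRight]
  refine (heq_comp_comp (h₂ l) (h₂ l') (obj_eq l' m) ?_ (h₁ l')).symm
  refine (modifApp_add σ ⟨m.len⟩ ⟨1⟩).trans ?_
  exact heq_whiskerRight (obj_eq l ⟨1⟩) (obj_eq l' ⟨1⟩) rfl (modifApp_heq σ ⟨1⟩)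

/-- The modification of `W_l`-cones that is given by a morphism of algebras. -/
def modifOfAction {σ : (toFunctor l).obj ⟨0⟩ ⟶ (toFunctor l').obj ⟨0⟩}
    (h : σ ▷ pow T ⟨1⟩ ≫ action l' = action l ≫ σ) : l ⟶ l' :=
  have nat {n m : PiL} (f : n ⟶ m) :
      (toFunctor l).map f ≫ modifApp σ m = modifApp σ n ≫ (toFunctor l').map f := by
    rw [PiL.hat_fac f, Functor.map_comp, Functor.map_comp, Category.assoc, modifApp_dropLast h,
      ← Category.assoc, modifApp_ofDelta σ (PiL.hat f), Category.assoc]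
  { app := fun _ => { app := modifApp σ, naturality := fun _ _ => nat }
    naturality := fun n => natTrans_conj_ext _ _ fun k =>
      eq_conj_of_heq (obj_add l n k) (obj_add l' n k).symm (modifApp_add σ n k) }

lemma toAlgebra_map_surjective :
    Function.Surjective ((toAlgebra T X).map : (l ⟶ l') → (laxHom l ⟶ laxHom l')) := fun a => by
  have h : a.σ ▷ (toMnd T).t ≫ (laxHom l').action = (laxHom l).action ≫ a.σ := Mnd.trans_comm a
  rw [laxHom_action, laxHom_action] at h
  exact ⟨modifOfAction h, Mnd.hom₂_ext (modifApp_zero (l := l) (l' := l') a.σ)⟩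

/-- The 2-natural transformation from `W_l`-cones to algebras. -/
def toHomι (T : StrictPseudofunctor BDelta D) : CatTrans (Cone Wl T) (toMnd T).homι :=
  have nat {X Y : D} (f : X ⟶ Y) (l : CatTrans Wl (homFromComp Y T)) :
      laxHom ((conePre Wl T f).obj l) = (Mnd.ι D).map f ≫ laxHom l :=
    Mnd.laxHom_ext rfl <| by
      refine HEq.trans ?_ (Mnd.ι_comp_φ_heq f (laxHom l)).symm
      rw [laxHom_action]
      refine (Mnd.LaxHom.action_heq _).symm.trans ?_
      refine (heq_of_eq (laxHom_action _)).trans ((action_heq _).trans ?_)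
      exact heq_whiskerLeft rfl (obj_add l ⟨1⟩ ⟨0⟩) rfl (action_heq l).symm
  { app := fun X => toAlgebra T X.unop
    -- The underlying 2-cells `σ` on both sides agree by definition, so only their boundaries have
    -- to be identified, by `nat`.
    naturality := fun {Y X} f => CategoryTheory.Functor.ext (nat f.unop) fun l l' a =>
      eq_conj_of_heq (nat f.unop l) (nat f.unop l').symm
        (Mnd.trans_heq (nat f.unop l) (nat f.unop l') HEq.rfl)
    naturality₂ := fun {Y X f f'} α => natTrans_conj_ext _ _ fun l =>
      eq_conj_of_heq (nat f.unop l) (nat f'.unop l).symm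
        (Mnd.trans_heq (nat f.unop l) (nat f'.unop l) HEq.rfl) }

lemma nonempty_catIso (T : StrictPseudofunctor BDelta D) :
    Nonempty (CatIso (Cone Wl T) (toMnd T).homι) :=
  (toHomι T).nonempty_catIso (fun _ _ _ => toAlgebra_map_surjective)
    (fun _ _ _ => toAlgebra_map_injective)
    fun _ => ⟨toAlgebra_obj_injective, toAlgebra_obj_surjective⟩

end WlCone

lemma hasWeightedLimit_iff (T : StrictPseudofunctor BDelta D) :
    HasWeightedLimit Wl T ↔ (toMnd T).AdmitsEMObject := by
  obtain ⟨l⟩ := WlCone.nonempty_catIso T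
  exact ⟨fun h => h.congr l, fun h => h.congr l.symm⟩

end Cones

/-! ### The 2-functor on `𝚫` of a monad -/

namespace Delta

/-- A decomposition of a monotone function to an ordinal sum. -/
structure Split {a c k : Delta} (f : a ⟶ add c k) where
  fst : Delta
  snd : Delta
  eq : a = add fst snd
  fstHom : fst ⟶ c
  sndHom : snd ⟶ k
  fac : f = eqToHom eq ≫ addHom fstHom sndHom

/-- Every monotone function to an ordinal sum decomposes. -/
lemma nonempty_split {a c k : Delta} (f : a ⟶ add c k) : Nonempty (Split f) := by
  have hf (i : Fin a.len) : (f.fn i).val < c.len + k.len := (f.fn i).isLt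
  -- The cut is the least `x` from which on all values of `f` lie in the second summand; `a.len`
  -- qualifies vacuously. By minimality and monotonicity the values before `x` lie in the first
  -- summand.
  have hex : ∃ x, ∀ i : Fin a.len, x ≤ i.val → c.len ≤ (f.fn i).val :=
    ⟨a.len, fun i hi => absurd i.isLt (by omega)⟩
  classical
  let x := Nat.find hex
  have hx : x ≤ a.len := Nat.find_min' hex fun i hi => absurd i.isLt (by omega)
  have hge (i : Fin a.len) (hi : x ≤ i.val) : c.len ≤ (f.fn i).val := Nat.find_spec hex i hi
  have hlt (i : Fin a.len) (hi : i.val < x) : (f.fn i).val < c.len := by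
    by_contra h
    exact Nat.find_min hex hi fun j hj => (not_lt.1 h).trans (f.mono (show i ≤ j from hj))
  refine ⟨⟨⟨x⟩, ⟨a.len - x⟩, Delta.ext (by simp; omega),
    ⟨fun i => ⟨(f.fn ⟨i.val, i.isLt.trans_le hx⟩).val, hlt _ i.isLt⟩, fun i j h => f.mono h⟩,
    ⟨fun i => ⟨(f.fn ⟨x + i.val, by have := i.isLt; simp only at this; omega⟩).val - c.len, ?_⟩,
      fun i j h => ?_⟩, ?_⟩⟩
  · have := hge ⟨x + i.val, by have := i.isLt; simp only at this; omega⟩ (by simp)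
    have := hf ⟨x + i.val, by have := i.isLt; simp only at this; omega⟩
    omega
  · exact Nat.sub_le_sub_right (f.mono (Nat.add_le_add_left h x)) _
  · refine act_ext_lt fun i hi => ?_
    rw [act_comp, act_eqToHom, act_addHom]
    by_cases h : i < x
    · simp [act, hi, h]
    · have := hge ⟨i, hi⟩ (not_lt.1 h)
      simp only [h, if_false, act, hi, dif_pos]
      rw [dif_pos (by omega)]
      simp only [show x + (i - x) = i by omega]
      omega

/-- If `a` were longer than `a'`, the index `a'.len` would be sent into `c` by one sum and beyond
`c` by the other. -/
lemma split_fst_len_le {a b a' b' c k : Delta} {f : a ⟶ c} {g : b ⟶ k} {f' : a' ⟶ c} {g' : b' ⟶ k}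
    (h : ∀ x, act (addHom f g) x = act (addHom f' g') x) : a.len ≤ a'.len := by
  by_contra hlt
  have := h a'.len
  rw [act_addHom, act_addHom, if_pos (by omega), if_neg (by omega)] at this
  have := act_lt f (show a'.len < a.len by omega)
  omega

/-- Decompositions are unique. -/
lemma Split.fst_unique {a b c k : Delta} {f : a ⟶ c} {g : b ⟶ k} (s : Split (addHom f g)) :
    s.fst = a ∧ s.snd = b ∧ s.fstHom ≍ f := by
  obtain ⟨a', b', e, f', g', h⟩ := s
  have h' (x : ℕ) : act (addHom f g) x = act (addHom f' g') x := by
    conv_lhs => rw [h]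
    simp
  obtain rfl : a' = a :=
    Delta.ext (le_antisymm (split_fst_len_le fun x => (h' x).symm) (split_fst_len_le h'))
  obtain rfl : b' = b := Delta.ext (by have := congrArg Delta.len e; simp at this; omega)
  refine ⟨rfl, rfl, heq_of_eq (act_ext_lt fun x hx => ?_)⟩
  have := h' x
  rw [act_addHom, act_addHom, if_pos hx, if_pos hx] at this
  exact this.symm

end Delta

/-! ### Iterated multiplications of a monad -/

namespace Mnd

variable {D : Type u} [Bicategory.{w, v} D] (M : Mnd D)

/-- The iterates of the 1-cell of a monad. -/
def iter : ℕ → (M.obj ⟶ M.obj)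
  | 0 => 𝟙 M.obj
  | n + 1 => M.t ≫ iter n

/-- The iterated multiplications of a monad. -/
def fold : ∀ n, M.iter n ⟶ M.t
  | 0 => M.η
  | n + 1 => M.t ◁ fold n ≫ M.μ

variable [Strict D]

lemma iter_add (n m : ℕ) : M.iter (n + m) = M.iter m ≫ M.iter n := by
  induction m with
  | zero => exact (Strict.id_comp _).symm
  | succ m ih => exact (congrArg (M.t ≫ ·) ih).trans (Strict.assoc _ _ _).symm

lemma fold_one_heq : M.fold 1 ≍ 𝟙 M.t := by
  change M.t ◁ M.η ≫ M.μ ≍ _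
  rw [M.unit_right, Strict.rightUnitor_eqToIso]
  exact eqToHom_heq_id_cod _ _ (Strict.comp_id _)

/-- General associativity: two blocks may be multiplied separately and the results then multiplied.
The induction is on the block composed first, since `iter` and `fold` recurse there; `unit_left`
starts it and `assoc` gives the step. -/
lemma fold_add_heq (c k : ℕ) :
    M.fold k ▷ M.iter c ≫ M.t ◁ M.fold c ≫ M.μ ≍ M.fold (c + k) := by
  induction k with
  | zero =>
    change M.η ▷ M.iter c ≫ M.t ◁ M.fold c ≫ M.μ ≍ M.fold c
    rw [← whisker_exchange_assoc, M.unit_left, Strict.leftUnitor_eqToIso]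
    exact (comp_eqToHom_heq _ (Strict.id_comp M.t)).trans (id_whiskerLeft_heq _)
  | succ k ih =>
    have e : (M.t ◁ M.fold k ≫ M.μ) ▷ M.iter c ≫ M.t ◁ M.fold c ≫ M.μ =
        (α_ M.t (M.iter k) (M.iter c)).hom ≫
          M.t ◁ (M.fold k ▷ M.iter c ≫ M.t ◁ M.fold c ≫ M.μ) ≫ M.μ := by
      rw [comp_whiskerRight, Category.assoc ((M.t ◁ M.fold k) ▷ M.iter c),
        ← whisker_exchange_assoc, M.assoc]
      simp
    refine (heq_of_eq e).trans ?_
    rw [Strict.associator_eqToIso]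
    refine (eqToHom_comp_heq _ (Strict.assoc _ _ _)).trans ?_
    exact heq_comp_comp (congrArg (M.t ≫ ·) (M.iter_add c k).symm) rfl rfl
      (heq_whiskerLeft rfl (M.iter_add c k).symm rfl ih) HEq.rfl

end Mnd

namespace Delta

lemma eq_zero_of_hom {a : Delta} (f : a ⟶ (⟨0⟩ : Delta)) : a = ⟨0⟩ :=
  Delta.ext (Nat.eq_zero_of_not_pos fun h => (f.fn ⟨0, h⟩).elim0)

instance (a : Delta) : Subsingleton (a ⟶ (⟨0⟩ : Delta)) :=
  ⟨fun f _ => Hom.ext (funext fun i => (f.fn i).elim0)⟩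

/-- Monotone functions are ordinal sums of maps to the terminal object. -/
lemma hom_induction {P : ∀ (b : ℕ) {a : Delta}, (a ⟶ (⟨b⟩ : Delta)) → Prop}
    (zero : P 0 (𝟙 (⟨0⟩ : Delta)))
    (succ : ∀ (b : ℕ) {a k : Delta} (f : a ⟶ (⟨b⟩ : Delta)) (g : k ⟶ (⟨1⟩ : Delta)),
      P b f → P (b + 1) (addHom f g)) : ∀ (b : ℕ) {a : Delta} (f : a ⟶ (⟨b⟩ : Delta)), P b f
  | 0, a, f => by
    obtain rfl := eq_zero_of_hom f
    rwa [Subsingleton.elim f (𝟙 _)]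
  | b + 1, a, f => by
    obtain ⟨a₁, a₂, rfl, f₁, f₂, h⟩ := nonempty_split (c := ⟨b⟩) (k := ⟨1⟩) f
    rw [eqToHom_refl, Category.id_comp] at h
    rw [h]
    exact succ b f₁ f₂ (hom_induction zero succ b f₁)

end Delta

section Whisker

variable {D : Type u} [Bicategory.{w, v} D]

/-- Associativity of the horizontal composition of 2-cells, with horizontal composites written by
whiskerings. -/
lemma comp_whisker_heq [Strict D] {X Y Z W : D} {c d : Y ⟶ Z} {a b : Z ⟶ W} {k t : X ⟶ Y}
    (φ : k ⟶ t) (G : c ⟶ d) (F : a ⟶ b) :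
    φ ▷ (c ≫ a) ≫ t ◁ (G ▷ a ≫ d ◁ F) ≍ (φ ▷ c ≫ t ◁ G) ▷ a ≫ (t ≫ d) ◁ F := by
  have h : (φ ▷ c ≫ t ◁ G) ▷ a ≫ (t ≫ d) ◁ F =
      (α_ k c a).hom ≫ (φ ▷ (c ≫ a) ≫ t ◁ (G ▷ a ≫ d ◁ F)) ≫ (α_ t d b).inv := by simp
  rw [h, Strict.associator_eqToIso, Strict.associator_eqToIso]
  exact (heq_conj (Strict.assoc _ _ _) (Strict.assoc _ _ _).symm _).symm

/-- The interchange law for vertical and horizontal composition, in whiskered form. -/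
lemma whisker_comp_whisker {X Y Z : D} {k k' t : X ⟶ Y} {a b c : Y ⟶ Z} (α : k ⟶ k')
    (φ : k' ⟶ t) (β : a ⟶ b) (γ : b ⟶ c) :
    (α ▷ a ≫ k' ◁ β) ≫ φ ▷ b ≫ t ◁ γ = (α ≫ φ) ▷ a ≫ t ◁ (β ≫ γ) := by
  rw [Category.assoc (α ▷ a), whisker_exchange_assoc, comp_whiskerRight, whiskerLeft_comp,
    Category.assoc (α ▷ a)]

end Whisker

/-! ### The interpretation of monotone maps in a monad -/

namespace Mnd

variable {D : Type u} [Bicategory.{w, v} D] [Strict D] (M : Mnd D)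

/-- The 2-cell for the ordinal sum of a monotone function and a map to the terminal object. -/
def foldSucc (c k : ℕ) {b : ℕ} (φ : M.iter c ⟶ M.iter b) : M.iter (c + k) ⟶ M.iter (b + 1) :=
  eqToHom (M.iter_add c k) ≫ M.fold k ▷ M.iter c ≫ M.t ◁ φ

lemma foldSucc_heq (c k : ℕ) {b : ℕ} (φ : M.iter c ⟶ M.iter b) :
    M.foldSucc c k φ ≍ M.fold k ▷ M.iter c ≫ M.t ◁ φ := eqToHom_comp_heq _ _

/-- The interpretation of a monotone function as a 2-cell between the iterates of a monad. -/
noncomputable def foldMap :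
    ∀ (b : ℕ) {a : Delta}, (a ⟶ (⟨b⟩ : Delta)) → (M.iter a.len ⟶ M.iter b)
  | 0, _, f => eqToHom (congrArg (fun a => M.iter (Delta.len a)) (Delta.eq_zero_of_hom f))
  | b + 1, _, f =>
    -- The fibre over the last element of the codomain is split off and folded; the rest is treated
    -- recursively. Since decompositions are unique, the choice does not matter.
    let s := Classical.choice (Delta.nonempty_split (c := ⟨b⟩) (k := ⟨1⟩) f)
    eqToHom (congrArg (fun a => M.iter (Delta.len a)) s.eq) ≫
      M.foldSucc s.fst.len s.snd.len (foldMap b s.fstHom)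

lemma foldMap_zero (f : (⟨0⟩ : Delta) ⟶ ⟨0⟩) : M.foldMap 0 f = 𝟙 (M.iter 0) := rfl

lemma exists_foldMap_succ {b : ℕ} {a : Delta} (f : a ⟶ Delta.add ⟨b⟩ ⟨1⟩) :
    ∃ s : Delta.Split f, M.foldMap (b + 1) f =
      eqToHom (congrArg (fun a => M.iter (Delta.len a)) s.eq) ≫
        M.foldSucc s.fst.len s.snd.len (M.foldMap b s.fstHom) :=
  ⟨_, rfl⟩

/-- Uniqueness of decompositions identifies the chosen one with the given one. This is the recursion
equation of `foldMap`, free of choices. -/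
lemma foldMap_addHom_terminal {b : ℕ} {a k : Delta} (f : a ⟶ (⟨b⟩ : Delta))
    (g : k ⟶ (⟨1⟩ : Delta)) :
    M.foldMap (b + 1) (Delta.addHom f g) = M.foldSucc a.len k.len (M.foldMap b f) := by
  obtain ⟨s, hs⟩ := M.exists_foldMap_succ (Delta.addHom f g)
  rw [hs]
  have hu := s.fst_unique
  clear hs
  obtain ⟨a', k', e, f', g', h⟩ := s
  dsimp only at hu
  obtain ⟨rfl, rfl, hf⟩ := hu
  obtain rfl := eq_of_heq hf
  exact Category.id_comp _

lemma foldMap_heq {b : ℕ} {a a' : Delta} (h : a = a') {f : a ⟶ (⟨b⟩ : Delta)}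
    {f' : a' ⟶ (⟨b⟩ : Delta)} (hf : f ≍ f') : M.foldMap b f ≍ M.foldMap b f' := by
  subst h; rw [eq_of_heq hf]

lemma foldMap_id (n : ℕ) : M.foldMap n (𝟙 (⟨n⟩ : Delta)) = 𝟙 (M.iter n) := by
  induction n with
  | zero => rfl
  | succ n ih =>
    have h := M.foldMap_addHom_terminal (𝟙 (⟨n⟩ : Delta)) (𝟙 (⟨1⟩ : Delta))
    rw [Delta.addHom_id, ih] at h
    refine h.trans (eq_of_heq ((M.foldSucc_heq n 1 _).trans ?_))
    rw [whiskerLeft_id]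
    refine (heq_of_eq (Category.comp_id _)).trans ?_
    refine (heq_whiskerRight (Strict.comp_id M.t) rfl rfl M.fold_one_heq).trans ?_
    exact heq_of_eq (id_whiskerRight _ _)

lemma foldMap_terminal {k : Delta} (g : k ⟶ (⟨1⟩ : Delta)) : M.foldMap 1 g ≍ M.fold k.len := by
  have h := M.foldMap_addHom_terminal (𝟙 (⟨0⟩ : Delta)) g
  rw [foldMap_zero] at h
  have e : Delta.addHom (𝟙 (⟨0⟩ : Delta)) g ≍ g :=
    (heq_of_eq (Delta.zero_addHom g)).trans (heq_conj _ _ _)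
  refine (M.foldMap_heq (Delta.zero_add k) e).symm.trans ((heq_of_eq h).trans ?_)
  refine (M.foldSucc_heq 0 k.len (𝟙 _)).trans ?_
  rw [whiskerLeft_id]
  exact (heq_of_eq (Category.comp_id _)).trans (whiskerRight_id_heq _)

/-- Folding every fibre and then folding the results is folding everything at once, by induction
from `fold_add_heq`. It is the case of functoriality where the second map goes to `1`. -/
lemma foldMap_comp_fold (b : ℕ) {a : Delta} (f : a ⟶ (⟨b⟩ : Delta)) :
    M.foldMap b f ≫ M.fold b = M.fold a.len := by
  refine Delta.hom_induction (P := fun b a f => M.foldMap b f ≫ M.fold b = M.fold a.len)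
    (Category.id_comp _) (fun b a k f g ih => ?_) b f
  rw [foldMap_addHom_terminal]
  refine eq_of_heq (HEq.trans ?_ (M.fold_add_heq a.len k.len))
  change _ ≫ M.t ◁ M.fold b ≫ M.μ ≍ _
  refine (heq_comp_comp (M.iter_add _ _) rfl rfl (M.foldSucc_heq _ _ _) HEq.rfl).trans ?_
  refine (heq_of_eq (Category.assoc _ (M.t ◁ M.foldMap b f) (M.t ◁ M.fold b ≫ M.μ))).trans ?_
  rw [← whiskerLeft_comp_assoc, ih]

/-- Ordinal sums become horizontal composites. The induction splits maps to `1` off `g`, and its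
step is associativity of the sum against that of horizontal composition. -/
lemma foldMap_addHom {a b : Delta} (f : a ⟶ b) (d : ℕ) {c : Delta} (g : c ⟶ (⟨d⟩ : Delta)) :
    M.foldMap (b.len + d) (Delta.addHom f g) ≍
      M.foldMap d g ▷ M.iter a.len ≫ M.iter d ◁ M.foldMap b.len f := by
  refine Delta.hom_induction (P := fun d c g => M.foldMap (b.len + d) (Delta.addHom f g) ≍
      M.foldMap d g ▷ M.iter a.len ≫ M.iter d ◁ M.foldMap b.len f) ?_ (fun d c k g h ih => ?_) d g
  · have e : Delta.addHom f (𝟙 (⟨0⟩ : Delta)) = f :=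
      (Delta.addHom_zero f).trans ((Category.id_comp _).trans (Category.comp_id _))
    rw [e, foldMap_zero, id_whiskerRight]
    exact (id_whiskerLeft_heq _).symm.trans (heq_of_eq (Category.id_comp _).symm)
  · have e : Delta.addHom f (Delta.addHom g h) ≍ Delta.addHom (Delta.addHom f g) h :=
      (heq_of_eq (Delta.addHom_assoc' f g h)).trans (heq_conj _ _ _)
    have e' := M.foldMap_addHom_terminal (b := b.len + d) (Delta.addHom f g) h
    refine (M.foldMap_heq (b := b.len + d + 1) (Delta.add_assoc a c k).symm e).trans ?_
    refine (heq_of_eq e').trans ((M.foldSucc_heq _ _ _).trans ?_)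
    rw [foldMap_addHom_terminal]
    refine (heq_comp_comp (congrArg (_ ≫ ·) (M.iter_add a.len c.len))
      (congrArg (M.t ≫ ·) (M.iter_add a.len c.len)) (congrArg (M.t ≫ ·) (M.iter_add b.len d))
      (heq_whiskerRight rfl rfl (M.iter_add a.len c.len) HEq.rfl)
      (heq_whiskerLeft rfl (M.iter_add a.len c.len) (M.iter_add b.len d) ih)).trans ?_
    refine (comp_whisker_heq _ _ _).trans ?_
    exact heq_comp_comp (congrArg (· ≫ _) (M.iter_add _ _).symm) rfl rfl
      (heq_whiskerRight (M.iter_add _ _).symm rfl rfl (M.foldSucc_heq _ _ _).symm) HEq.rfl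

/-- For a second map `g + h` with `h` going to `1`, the first map decomposes as `f₁ + f₂`. The part
over `g` is the induction hypothesis, the part over `h` is `foldMap_comp_fold`, and interchange
assembles them. -/
lemma foldMap_comp {a : Delta} {b : Delta} (f : a ⟶ b) (p : ℕ) (g : b ⟶ (⟨p⟩ : Delta)) :
    M.foldMap p (f ≫ g) = M.foldMap b.len f ≫ M.foldMap p g := by
  -- The predicate quantifies over `f`, because the induction hypothesis is applied to its first
  -- part `f₁`.
  refine Delta.hom_induction (P := fun p b g => ∀ {a : Delta} (f : a ⟶ b),
    M.foldMap p (f ≫ g) = M.foldMap b.len f ≫ M.foldMap p g) (fun {a} f => ?_)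
    (fun p b k g h ih a f => ?_) p g f
  · rw [Category.comp_id, foldMap_zero]
    exact (Category.comp_id _).symm
  · obtain ⟨a₁, a₂, rfl, f₁, f₂, hf⟩ := Delta.nonempty_split f
    rw [eqToHom_refl, Category.id_comp] at hf
    have e := M.foldMap_addHom_terminal (f₁ ≫ g) (f₂ ≫ h)
    rw [Delta.addHom_comp, ← hf, ih] at e
    refine e.trans (eq_of_heq ((M.foldSucc_heq _ _ _).trans ?_))
    rw [← M.foldMap_comp_fold _ f₂, foldMap_addHom_terminal, hf, ← whisker_comp_whisker]
    exact (heq_comp_comp (M.iter_add _ _) (M.iter_add _ _) rfl (M.foldMap_addHom f₁ _ f₂)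
      (M.foldSucc_heq _ _ _)).symm

/-- The 2-functor `𝚫 → D` of a monad in `D`. -/
noncomputable def toStrictPseudofunctor : StrictPseudofunctor BDelta D :=
  StrictPseudofunctor.mk''
    { obj := fun _ => M.obj
      map := fun n => M.iter (Delta.len n)
      map₂ := fun {_ _ _ n} f => M.foldMap (Delta.len n) f
      map₂_id := fun n => M.foldMap_id (Delta.len n)
      map₂_comp := fun {_ _ _ _ n} f g => M.foldMap_comp f (Delta.len n) g
      map_id := fun _ => rfl
      map_comp := fun m n => M.iter_add (Delta.len n) (Delta.len m)
      map₂_whisker_left := fun m n n' f => by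
        refine eq_conj_of_heq _ _ ((M.foldMap_addHom f (Delta.len m) (𝟙 m)).trans ?_)
        rw [show M.foldMap (Delta.len m) (𝟙 m) = 𝟙 _ from M.foldMap_id _, id_whiskerRight]
        exact heq_of_eq (Category.id_comp _)
      map₂_whisker_right := fun {_ _ _ m m'} f n => by
        refine eq_conj_of_heq _ _ ((M.foldMap_addHom (𝟙 n) (Delta.len m') f).trans ?_)
        rw [show M.foldMap (Delta.len n) (𝟙 n) = 𝟙 _ from M.foldMap_id _, whiskerLeft_id]
        exact heq_of_eq (Category.comp_id _) }

lemma mk_eq {C : D} {t s : C ⟶ C} {e : 𝟙 C ⟶ t} {m : t ≫ t ⟶ t} {e' : 𝟙 C ⟶ s}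
    {m' : s ≫ s ⟶ s} {h₁ h₂ h₃ h₁' h₂' h₃'} (ht : t = s) (he : e ≍ e') (hm : m ≍ m') :
    Mnd.mk C t e m h₁ h₂ h₃ = Mnd.mk C s e' m' h₁' h₂' h₃' := by
  subst ht
  obtain rfl := eq_of_heq he
  obtain rfl := eq_of_heq hm
  rfl

lemma fold_two_heq : M.fold 2 ≍ M.μ := by
  change M.t ◁ M.fold 1 ≫ M.μ ≍ M.μ
  refine (heq_comp_comp (congrArg (M.t ≫ ·) (Strict.comp_id M.t)) rfl rfl
    (heq_whiskerLeft rfl (Strict.comp_id M.t) rfl M.fold_one_heq) HEq.rfl).trans ?_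
  rw [whiskerLeft_id, Category.id_comp M.μ]

/-- Strictness gives `t ≫ 𝟙 = t` for the 1-cell, and the folds of lengths `0` and `2` are `η` and
`μ`. The result is an equality of monads, so properties of monads of the form `toMnd T` hold for all
monads. -/
lemma toMnd_toStrictPseudofunctor : toMnd M.toStrictPseudofunctor = M :=
  mk_eq (Strict.comp_id M.t)
    ((toMnd_η_heq M.toStrictPseudofunctor).trans
      ((M.foldMap_terminal (Delta.bang ⟨0⟩)).trans HEq.rfl))
    ((toMnd_μ_heq M.toStrictPseudofunctor).trans
      ((M.foldMap_terminal (Delta.bang (Delta.add ⟨1⟩ ⟨1⟩))).trans M.fold_two_heq))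

end Mnd

/-- One direction transports along `toMnd_toStrictPseudofunctor`; the other applies the hypothesis
to the monad underlying `T`. -/
lemma hasWlLimits_iff (D : Type u) [Bicategory.{w, v} D] [Strict D] :
    HasWlLimits D ↔ ∀ T : Mnd D, T.AdmitsEMObject :=
  ⟨fun h T => T.toMnd_toStrictPseudofunctor ▸ (hasWeightedLimit_iff _).1 (h _),
    fun h T => (hasWeightedLimit_iff T).2 (h _)⟩

end TwoCat

theorem mainTheorem4 (D : Type u) [Bicategory.{w, v} D] [Bicategory.Strict D] :
    (TwoCat.AdmitsEMObjects D ↔ TwoCat.HasWlLimits D) ∧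
      ((∀ T : TwoCat.Mnd D, T.AdmitsEMObject) ↔ TwoCat.HasWlLimits D) :=
  ⟨TwoCat.admitsEMObjects_iff.trans (TwoCat.hasWlLimits_iff D).symm,
    (TwoCat.hasWlLimits_iff D).symm⟩
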